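/- \textbf{Setting.} Let $1\le l\le d$ be integers, $\mathcal Z$ a measurable space, $Z$ a $\mathcal Z$-valued random variable and $F:\mathbb R^d\times\mathcal Z\to\mathbb R$ such that $F(x,\cdot)$ is measurable and $F(x,Z)$ is integrable for every $x\in\mathbb R^d$. Put $f(x)=\mathbb E[F(x,Z)]$ and assume that $f$ has a minimizer. Write $\nabla F(x,z)$ for the gradient in $x$. Assume: (a) for every $z\in\mathcal Z$ the function $F(\cdot,z)$ is convex and differentiable, with $\lambda$-Lipschitz gradient, where $\lambda>0$ does not depend on $z$; (b) there is $G>0$ such that for every $x\in\mathbb R^d$ the random vector $\nabla F(x,Z)$ is integrable, $\mathbb E[\nabla F(x,Z)]=\nabla f(x)$ and $\mathbb E\big[\|\nabla F(x,Z)-\nabla f(x)\|^2\big]\le G$; (c) $(\alpha_k)_{k\ge0}$ and $(h_k)_{k\ge0}$ are positive sequences with $\sum_k\alpha_k=\infty$, $\sum_k\alpha_k^2<\infty$, $\sum_k\alpha_kh_k<\infty$, and there is $\bar\alpha$ with $\alpha_k\le\bar\alpha<l/(d\lambda)$ for every $k$; (d) $(Z_k)_{k\ge0}$ are independent copies of $Z$,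 $(P_k)_{k\ge0}$ are independent random matrices with values in $\mathbb R^{d\times l}$ such that $\mathbb E[P_kP_k^\top]=I$ and $P_k^\top P_k=\frac dl I$ almost surely for every $k$, and the sequences $(Z_k)_k$ and $(P_k)_k$ are independent of each other. Let $p_k^{(i)}$ be the $i$-th column of $P_k$. Given a deterministic $x_0\in\mathbb R^d$, the S-SZD iterates are $$x_{k+1}=x_k-\alpha_k\sum_{i=1}^l\frac{F(x_k+h_kp_k^{(i)},Z_k)-F(x_k,Z_k)}{h_k}\,p_k^{(i)},\qquad k\ge0 .$$ Let $\bar x_k=\sum_{i=0}^k\alpha_ix_i\big/\sum_{i=0}^k\alpha_i$, $\Delta=\frac1\lambda-\frac{\bar\alpha d}{l}$ and $\rho_k=\frac{\lambda d\sqrt d}{l}\alpha_kh_k$. \textbf{Theorem.} For every minimizer $x^*$ of $f$ and every $k\ge0$, the random variable $f(\bar x_k)$ is integrable and $$\mathbb E[f(\bar x_k)-\min f]\le \frac{C}{\sum_{i=0}^k\alpha_i},\qquad C=\frac{l\Delta+d\bar\alpha}{2l\Delta}\Big(S+\sum_{j=0}^\infty\rho_j\Big(\sqrt S+\sum_{i=0}^j\rho_i\Big)\Big),$$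 $$S=\|x_0-x^*\|^2+\sum_{j=0}^\infty\frac{\alpha_j^2d}{l}\Big(\frac{\lambda^2h_j^2d^2}{2l}+2G\Big),$$ where both infinite series converge. Moreover, there is a random variable $X$ that is almost surely a minimizer of $f$ and such that $x_k\to X$ almost surely. -/

import Mathlib

open MeasureTheory ProbabilityTheory Filter Topology

open scoped Matrix

namespace SSZD

noncomputable section

/-- Real matrices carry the product (Borel) σ-algebra of their entries. -/
instance instMeasurableSpaceMatrix {m n : Type*} : MeasurableSpace (Matrix m n ℝ) :=
  inferInstanceAs (MeasurableSpace (m → n → ℝ))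

/-- The `i`-th column of `P`, as a vector of the Euclidean space `ℝ^d`. -/
def dir {d l : ℕ} (P : Matrix (Fin d) (Fin l) ℝ) (i : Fin l) : EuclideanSpace ℝ (Fin d) :=
  WithLp.toLp 2 (fun j => P j i)

/-- The vector `D_{(P,h)} F(x,z)` of finite differences of `F(·, z)` at `x`
along the columns of `P`, with discretization parameter `h`. -/
def finiteDiff {d l : ℕ} {𝒵 : Type*} (F : EuclideanSpace ℝ (Fin d) → 𝒵 → ℝ)
    (P : Matrix (Fin d) (Fin l) ℝ) (h : ℝ) (x : EuclideanSpace ℝ (Fin d)) (z : 𝒵) :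
    Fin l → ℝ :=
  fun i => (F (x + h • dir P i) z - F x z) / h

/-- The surrogate `∇_{(P,h)} F(x,z) = P D_{(P,h)} F(x,z)` of the stochastic gradient. -/
def surrogate {d l : ℕ} {𝒵 : Type*} (F : EuclideanSpace ℝ (Fin d) → 𝒵 → ℝ)
    (P : Matrix (Fin d) (Fin l) ℝ) (h : ℝ) (x : EuclideanSpace ℝ (Fin d)) (z : 𝒵) :
    EuclideanSpace ℝ (Fin d) :=
  ∑ i : Fin l, finiteDiff F P h x z i • dir P i

/-- The iterates of S-SZD:
`x_{k+1} = x_k - α_k ∇_{(P_k, h_k)} F(x_k, Z_k)`, started at the deterministic point `x₀`. -/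
def iterate {d l : ℕ} {𝒵 Ω : Type*} (F : EuclideanSpace ℝ (Fin d) → 𝒵 → ℝ)
    (α h : ℕ → ℝ) (x₀ : EuclideanSpace ℝ (Fin d))
    (P : ℕ → Ω → Matrix (Fin d) (Fin l) ℝ) (Zs : ℕ → Ω → 𝒵) :
    ℕ → Ω → EuclideanSpace ℝ (Fin d)
  | 0, _ => x₀
  | k + 1, ω =>
      iterate F α h x₀ P Zs k ω
        - α k • surrogate F (P k ω) (h k) (iterate F α h x₀ P Zs k ω) (Zs k ω)

/-- The step-size weighted average `(∑_{i ≤ k} α_i x_i) / (∑_{i ≤ k} α_i)`. -/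
def average {E Ω : Type*} [AddCommGroup E] [Module ℝ E] (α : ℕ → ℝ) (x : ℕ → Ω → E)
    (k : ℕ) (ω : Ω) : E :=
  (∑ i ∈ Finset.range (k + 1), α i)⁻¹ • ∑ i ∈ Finset.range (k + 1), α i • x i ω

/-- The objective `f(x) = E[F(x, Z)]`. -/
def objective {E 𝒵 Ω₀ : Type*} [MeasurableSpace Ω₀] (μ₀ : Measure Ω₀)
    (F : E → 𝒵 → ℝ) (Z : Ω₀ → 𝒵) (x : E) : ℝ :=
  ∫ ω, F x (Z ω) ∂μ₀

/-- Random direction matrices: `E[P Pᵀ] = I` (entrywise) and `Pᵀ P = (d / l) I` almost surely. -/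
structure IsDirectionMatrix {d l : ℕ} {Ω : Type*} [MeasurableSpace Ω] (μ : Measure Ω)
    (P : Ω → Matrix (Fin d) (Fin l) ℝ) : Prop where
  measurable : Measurable P
  expectation : ∀ i j, ∫ ω, (P ω * (P ω)ᵀ) i j ∂μ = (1 : Matrix (Fin d) (Fin d) ℝ) i j
  orthogonal : ∀ᵐ ω ∂μ, (P ω)ᵀ * P ω = ((d : ℝ) / (l : ℝ)) • (1 : Matrix (Fin l) (Fin l) ℝ)

/-- Every `F(·, z)` is differentiable with `lam`-Lipschitz gradient. -/
structure IsSmooth {d : ℕ} {𝒵 : Type*} (F : EuclideanSpace ℝ (Fin d) → 𝒵 → ℝ)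
    (lam : ℝ) : Prop where
  pos : 0 < lam
  differentiable : ∀ z, Differentiable ℝ (fun x => F x z)
  lipschitz : ∀ z x y,
    ‖gradient (fun x' => F x' z) x - gradient (fun x' => F x' z) y‖ ≤ lam * ‖x - y‖

/-- The stochastic gradient is unbiased and its variance is bounded by `G`, uniformly in `x`. -/
structure IsUnbiasedBounded {d : ℕ} {𝒵 Ω₀ : Type*} [MeasurableSpace Ω₀] (μ₀ : Measure Ω₀)
    (F : EuclideanSpace ℝ (Fin d) → 𝒵 → ℝ) (Z : Ω₀ → 𝒵) (G : ℝ) : Prop where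
  pos : 0 < G
  integrable_grad : ∀ x, Integrable (fun ω => gradient (fun x' => F x' (Z ω)) x) μ₀
  unbiased : ∀ x,
    ∫ ω, gradient (fun x' => F x' (Z ω)) x ∂μ₀ = gradient (objective μ₀ F Z) x
  integrable_sq : ∀ x, Integrable (fun ω =>
    ‖gradient (fun x' => F x' (Z ω)) x - gradient (objective μ₀ F Z) x‖ ^ 2) μ₀
  variance_le : ∀ x,
    ∫ ω, ‖gradient (fun x' => F x' (Z ω)) x - gradient (objective μ₀ F Z) x‖ ^ 2 ∂μ₀ ≤ G

/-- Conditions on the step sizes `α` and the discretization parameters `h`. -/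
structure IsStepDisc (d l : ℕ) (lam αbar : ℝ) (α h : ℕ → ℝ) : Prop where
  α_pos : ∀ k, 0 < α k
  h_pos : ∀ k, 0 < h k
  not_summable : ¬ Summable α
  summable_sq : Summable (fun k => α k ^ 2)
  summable_mul : Summable (fun k => α k * h k)
  α_le : ∀ k, α k ≤ αbar
  αbar_lt : αbar < (l : ℝ) / ((d : ℝ) * lam)

/-- `Δ = 1 / λ - ᾱ d / l`. -/
def Delta (d l : ℕ) (lam αbar : ℝ) : ℝ := 1 / lam - αbar * d / l

/-- `ρ_k = (λ d √d / l) α_k h_k`. -/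
def rho (d l : ℕ) (lam : ℝ) (α h : ℕ → ℝ) (k : ℕ) : ℝ :=
  lam * d * √(d : ℝ) / l * (α k * h k)

/-- The `j`-th term `(α_j² d / l) (λ² h_j² d² / (2 l) + 2 G)` of the series in `S`. -/
def noiseTerm (d l : ℕ) (lam G : ℝ) (α h : ℕ → ℝ) (j : ℕ) : ℝ :=
  (α j ^ 2 * d / l) * (lam ^ 2 * h j ^ 2 * (d : ℝ) ^ 2 / (2 * l) + 2 * G)

/-- `S = ‖x₀ - x*‖² + ∑_j (α_j² d / l) (λ² h_j² d² / (2 l) + 2 G)`. -/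
def constS {d : ℕ} (l : ℕ) (lam G : ℝ) (α h : ℕ → ℝ) (x₀ xs : EuclideanSpace ℝ (Fin d)) : ℝ :=
  ‖x₀ - xs‖ ^ 2 + ∑' j, noiseTerm d l lam G α h j

/-- The `j`-th term `ρ_j (√S + ∑_{i ≤ j} ρ_i)` of the series in `C`. -/
def driftTerm {d : ℕ} (l : ℕ) (lam G : ℝ) (α h : ℕ → ℝ) (x₀ xs : EuclideanSpace ℝ (Fin d))
    (j : ℕ) : ℝ :=
  rho d l lam α h j *
    (√(constS l lam G α h x₀ xs) + ∑ i ∈ Finset.range (j + 1), rho d l lam α h i)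

/-- `C = (l Δ + d ᾱ) / (2 l Δ) * (S + ∑_j ρ_j (√S + ∑_{i ≤ j} ρ_i))`. -/
def constC {d : ℕ} (l : ℕ) (lam αbar G : ℝ) (α h : ℕ → ℝ)
    (x₀ xs : EuclideanSpace ℝ (Fin d)) : ℝ :=
  (l * Delta d l lam αbar + d * αbar) / (2 * l * Delta d l lam αbar) *
    (constS l lam G α h x₀ xs + ∑' j, driftTerm l lam G α h x₀ xs j)

end

end SSZD

/-! Fix a minimizer `s` of the objective `f` and follow the distance `r_k = ‖x_k - s‖`. The columns
of `P_k` are orthogonal with squared norm `d / l`, so a finite difference along a column misses the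
directional derivative by at most `λ h d / (2 l)`. The surrogate is thus `P Pᵀ ∇F`, whose mean is
`∇f`, plus an error of order `h`. Expanding the square and averaging over `P_k` and `Z_k` given the
past yields `E[r_{k+1}² | past] ≤ r_k² + ρ_k r_k + n_k - 2 λ Δ α_k (f(x_k) - f(s))`, with `n_k` the
noise term (`lintegral_step_le`, `setLIntegral_norm_sq_iterate_succ_le`). Cocoercivity, `‖∇f(x)‖² ≤
λ ⟨∇f(x), x - s⟩`, absorbs the second-order term in `‖∇f‖²` into the first-order decrease; the
condition `ᾱ < l / (d λ)` leaves the margin `Δ > 0`.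

The probabilistic analysis uses only this recursion, abstracted as `IsQuasiFejer`. Its perturbation
is linear in `r_k`, so a discrete Grönwall argument bounds the `L²` norm of `r_k` by `√S + ∑ ρ_i`.
Summing the recursion then bounds `∑ α_i E[f(x_i) - min f]`, and Jensen's inequality gives the rate
for the weighted average.

For almost sure convergence, `∑_{i<k} (ρ_i r_i + n_i) - r_k²` is an `L¹`-bounded submartingale, so
`r_k` converges almost surely. Moreover `∑ α_k (f(x_k) - min f)` is almost surely finite while `∑
α_k` diverges, so the values approach the minimum along a subsequence. An Opial-type argument, with
`s` running through a countable dense set of minimizers to keep a single null set, identifies the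
limit. -/

namespace SSZD

/-! ### Quadratic and tangent models of smooth convex functions. -/

section Smooth

variable {E : Type*} [NormedAddCommGroup E] [InnerProductSpace ℝ E]

/-- First-order expansion of a function with Lipschitz gradient. -/
lemma abs_sub_sub_inner_gradient_le [CompleteSpace E] {f : E → ℝ} {L : ℝ}
    (hf : Differentiable ℝ f) (hL : ∀ x y, ‖gradient f x - gradient f y‖ ≤ L * ‖x - y‖) (x v : E) :
    |f (x + v) - f x - inner ℝ (gradient f x) v| ≤ L / 2 * ‖v‖ ^ 2 := by
  have hline : ∀ t : ℝ, HasDerivAt (fun t : ℝ => x + t • v) v t := fun t => by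
    simpa using ((hasDerivAt_id t).smul_const v).const_add x
  have hder : ∀ t : ℝ, HasDerivAt
      (fun t : ℝ => f (x + t • v) - f x - t * inner ℝ (gradient f x) v)
      (inner ℝ (gradient f (x + t • v) - gradient f x) v) t := fun t => by
    have h1 := ((hf (x + t • v)).hasFDerivAt.comp_hasDerivAt t (hline t)).sub_const (f x)
    have h2 := h1.sub ((hasDerivAt_id t).mul_const (inner ℝ (gradient f x) v))
    rw [inner_sub_left, inner_gradient_left (f := f) (x := x + t • v)]
    rw [one_mul] at h2
    exact h2
  have hB : ∀ t : ℝ, HasDerivAt (fun t : ℝ => L * ‖v‖ ^ 2 / 2 * t ^ 2) (L * ‖v‖ ^ 2 * t) t :=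
    fun t => by
      have := (hasDerivAt_pow 2 t).const_mul (L * ‖v‖ ^ 2 / 2)
      refine this.congr_deriv ?_
      norm_num; ring
  -- The remainder along the segment vanishes at `0` and its derivative at `t` is at most `L ‖v‖²
  -- t`, the derivative of the comparison parabola.
  have key := image_norm_le_of_norm_deriv_right_le_deriv_boundary
    (f := fun t : ℝ => f (x + t • v) - f x - t * inner ℝ (gradient f x) v)
    (a := 0) (b := 1) (fun t _ => (hder t).continuousAt.continuousWithinAt)
    (fun t _ => (hder t).hasDerivWithinAt) (by simp) hB (fun t ht => by
      refine (norm_inner_le_norm _ _).trans ?_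
      have := hL (x + t • v) x
      rw [add_sub_cancel_left, norm_smul, Real.norm_of_nonneg ht.1] at this
      nlinarith [norm_nonneg v])
    (Set.right_mem_Icc.2 zero_le_one)
  simp only [one_smul, one_mul, Real.norm_eq_abs] at key
  linarith

/-- A differentiable convex function lies above its tangents. -/
lemma add_inner_gradient_le [CompleteSpace E] {f : E → ℝ} (hc : ConvexOn ℝ Set.univ f)
    (hf : Differentiable ℝ f) (x y : E) : f x + inner ℝ (gradient f x) (y - x) ≤ f y := by
  have hconv : ConvexOn ℝ Set.univ (fun t : ℝ => f (AffineMap.lineMap x y t)) := by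
    have := hc.comp_affineMap (AffineMap.lineMap (k := ℝ) x y)
    rwa [Set.preimage_univ] at this
  have hd : HasDerivAt (fun t : ℝ => f (AffineMap.lineMap x y t))
      (inner ℝ (gradient f x) (y - x)) 0 := by
    have h := (hf (AffineMap.lineMap x y (0 : ℝ))).hasFDerivAt.comp_hasDerivAt (0 : ℝ)
      AffineMap.hasDerivAt_lineMap
    rw [AffineMap.lineMap_apply_zero] at h
    rw [inner_gradient_left]
    exact h
  have := hconv.le_slope_of_hasDerivAt (Set.mem_univ 0) (Set.mem_univ 1) zero_lt_one hd
  rw [slope_def_field, AffineMap.lineMap_apply_one, AffineMap.lineMap_apply_zero, sub_zero,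
    div_one] at this
  linarith

variable {f : E → ℝ} {g : E → E} {L : ℝ} {s : E}

/-- A quadratic upper model forces the model gradient to vanish at a minimizer. -/
lemma eq_zero_of_isMinOn (hL : 0 < L)
    (hup : ∀ x y, f y ≤ f x + inner ℝ (g x) (y - x) + L / 2 * ‖y - x‖ ^ 2)
    (hs : IsMinOn f Set.univ s) : g s = 0 := by
  have h1 := hup s (s - L⁻¹ • g s)
  have h2 : f s ≤ f (s - L⁻¹ • g s) := hs (Set.mem_univ _)
  rw [sub_sub_cancel_left, inner_neg_right, inner_smul_right, real_inner_self_eq_norm_sq, norm_neg,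
    norm_smul, Real.norm_of_nonneg (inv_pos.2 hL).le] at h1
  have h3 : L / 2 * (L⁻¹ * ‖g s‖) ^ 2 = L⁻¹ * ‖g s‖ ^ 2 / 2 := by field_simp
  have h4 : L⁻¹ * ‖g s‖ ^ 2 ≤ 0 := by linarith
  have h5 : ‖g s‖ ^ 2 ≤ 0 := by
    by_contra hcon
    exact absurd h4 (not_le.2 (mul_pos (inv_pos.2 hL) (not_le.1 hcon)))
  exact norm_eq_zero.1 (pow_eq_zero_iff two_ne_zero |>.1 (le_antisymm h5 (sq_nonneg _)))

/-- Cocoercivity of the gradient of a smooth convex function with respect to a minimizer. -/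
lemma norm_sq_le_mul_inner_of_isMinOn (hL : 0 < L)
    (hlow : ∀ x y, f x + inner ℝ (g x) (y - x) ≤ f y)
    (hup : ∀ x y, f y ≤ f x + inner ℝ (g x) (y - x) + L / 2 * ‖y - x‖ ^ 2)
    (hs : IsMinOn f Set.univ s) (x : E) : ‖g x‖ ^ 2 ≤ L * inner ℝ (g x) (x - s) := by
  have h0 := eq_zero_of_isMinOn hL hup hs
  -- This test point maximizes the gap between the tangent at `x` and the quadratic model at `s`. It
  -- yields `f x - f s + ‖g x‖² / (2 L) ≤ ⟨g x, x - s⟩`.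
  have h1 := hlow x (s + L⁻¹ • g x)
  have h2 := hup s (s + L⁻¹ • g x)
  have h3 : f s ≤ f x := hs (Set.mem_univ _)
  have e : s + L⁻¹ • g x - x = L⁻¹ • g x - (x - s) := by abel
  rw [e, inner_sub_right, inner_smul_right, real_inner_self_eq_norm_sq] at h1
  rw [h0, inner_zero_left, add_sub_cancel_left, norm_smul,
    Real.norm_of_nonneg (inv_pos.2 hL).le] at h2
  have h4 : L / 2 * (L⁻¹ * ‖g x‖) ^ 2 = L⁻¹ * ‖g x‖ ^ 2 / 2 := by field_simp
  -- A gradient step from `x` gives `f x - f s ≥ ‖g x‖² / (2 L)`, the other half of the bound.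
  have h5 := hup x (x - L⁻¹ • g x)
  have h6 : f s ≤ f (x - L⁻¹ • g x) := hs (Set.mem_univ _)
  rw [sub_sub_cancel_left, inner_neg_right, inner_smul_right, real_inner_self_eq_norm_sq, norm_neg,
    norm_smul, Real.norm_of_nonneg (inv_pos.2 hL).le] at h5
  have h7 : L⁻¹ * ‖g x‖ ^ 2 ≤ inner ℝ (g x) (x - s) := by linarith
  calc ‖g x‖ ^ 2 = L * (L⁻¹ * ‖g x‖ ^ 2) := by field_simp
    _ ≤ _ := by gcongr

lemma sub_le_of_isMinOn (hL : 0 < L)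
    (hup : ∀ x y, f y ≤ f x + inner ℝ (g x) (y - x) + L / 2 * ‖y - x‖ ^ 2)
    (hs : IsMinOn f Set.univ s) (x : E) : f x - f s ≤ L / 2 * ‖x - s‖ ^ 2 := by
  have h := hup s x
  rw [eq_zero_of_isMinOn hL hup hs, inner_zero_left] at h
  linarith

end Smooth

/-! ### The objective inherits both models from its samples. -/

section Objective

variable {d : ℕ} {𝒵 Ω₀ : Type*} [MeasurableSpace Ω₀] {μ₀ : Measure Ω₀}
  {F : EuclideanSpace ℝ (Fin d) → 𝒵 → ℝ} {Z : Ω₀ → 𝒵} {lam G : ℝ}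

lemma convexOn_objective (hFint : ∀ x, Integrable (fun ω => F x (Z ω)) μ₀)
    (hconv : ∀ z, ConvexOn ℝ Set.univ (fun x => F x z)) :
    ConvexOn ℝ Set.univ (objective μ₀ F Z) := by
  refine ⟨convex_univ, fun x _ y _ a b ha hb hab => ?_⟩
  simp only [objective, smul_eq_mul]
  rw [← integral_const_mul, ← integral_const_mul,
    ← integral_add ((hFint x).const_mul a) ((hFint y).const_mul b)]
  refine integral_mono (hFint _) (((hFint x).const_mul a).add ((hFint y).const_mul b)) fun ω => ?_
  simpa using (hconv (Z ω)).2 (Set.mem_univ x) (Set.mem_univ y) ha hb hab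

lemma continuous_objective (hFint : ∀ x, Integrable (fun ω => F x (Z ω)) μ₀)
    (hconv : ∀ z, ConvexOn ℝ Set.univ (fun x => F x z)) :
    Continuous (objective μ₀ F Z) :=
  continuousOn_univ.1 ((convexOn_objective hFint hconv).continuousOn isOpen_univ)

lemma integral_inner_gradient (hunb : IsUnbiasedBounded μ₀ F Z G)
    (x v : EuclideanSpace ℝ (Fin d)) :
    ∫ ω, inner ℝ (gradient (fun x' => F x' (Z ω)) x) v ∂μ₀ =
      inner ℝ (gradient (objective μ₀ F Z) x) v := by
  rw [← hunb.unbiased x, real_inner_comm, ← integral_inner (hunb.integrable_grad x)]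
  simp_rw [real_inner_comm]

/-- The tangent inequality for `F(·, z)` is averaged over `z`, the linear term being identified by
unbiasedness. Differentiability of the objective is not needed, here or for the upper model below.
-/
lemma objective_add_inner_le (hFint : ∀ x, Integrable (fun ω => F x (Z ω)) μ₀)
    (hsmooth : IsSmooth F lam) (hunb : IsUnbiasedBounded μ₀ F Z G)
    (hconv : ∀ z, ConvexOn ℝ Set.univ (fun x => F x z)) (x y : EuclideanSpace ℝ (Fin d)) :
    objective μ₀ F Z x + inner ℝ (gradient (objective μ₀ F Z) x) (y - x) ≤
      objective μ₀ F Z y := by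
  rw [← integral_inner_gradient hunb]
  unfold objective
  have hi : Integrable (fun ω => inner ℝ (gradient (fun x' => F x' (Z ω)) x) (y - x)) μ₀ :=
    (hunb.integrable_grad x).inner_const (𝕜 := ℝ) (y - x)
  rw [← integral_add (hFint x) hi]
  exact integral_mono ((hFint x).add hi) (hFint y) fun ω =>
    add_inner_gradient_le (hconv (Z ω)) (hsmooth.differentiable (Z ω)) x y

lemma objective_le_add_inner [IsProbabilityMeasure μ₀]
    (hFint : ∀ x, Integrable (fun ω => F x (Z ω)) μ₀)
    (hsmooth : IsSmooth F lam) (hunb : IsUnbiasedBounded μ₀ F Z G)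
    (x y : EuclideanSpace ℝ (Fin d)) :
    objective μ₀ F Z y ≤ objective μ₀ F Z x
      + inner ℝ (gradient (objective μ₀ F Z) x) (y - x) + lam / 2 * ‖y - x‖ ^ 2 := by
  rw [← integral_inner_gradient hunb]
  unfold objective
  have hi : Integrable (fun ω => inner ℝ (gradient (fun x' => F x' (Z ω)) x) (y - x)) μ₀ :=
    (hunb.integrable_grad x).inner_const (𝕜 := ℝ) (y - x)
  have hc : ∫ _ : Ω₀, lam / 2 * ‖y - x‖ ^ 2 ∂μ₀ = lam / 2 * ‖y - x‖ ^ 2 := by simp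
  have hadd : Integrable (fun ω =>
      F x (Z ω) + inner ℝ (gradient (fun x' => F x' (Z ω)) x) (y - x)) μ₀ := (hFint x).add hi
  rw [← hc, ← integral_add (hFint x) hi, ← integral_add hadd (integrable_const _)]
  refine integral_mono (hFint y) (hadd.add (integrable_const _)) fun ω => ?_
  have := abs_le.1 (abs_sub_sub_inner_gradient_le (hsmooth.differentiable (Z ω))
    (hsmooth.lipschitz (Z ω)) x (y - x))
  rw [add_sub_cancel] at this
  linarith [this.2]

/-- Bias-variance decomposition of the second moment of the stochastic gradient. -/
lemma integral_norm_sq_gradient_le [IsProbabilityMeasure μ₀] (hunb : IsUnbiasedBounded μ₀ F Z G)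
    (x : EuclideanSpace ℝ (Fin d)) :
    Integrable (fun ω => ‖gradient (fun x' => F x' (Z ω)) x‖ ^ 2) μ₀ ∧
    ∫ ω, ‖gradient (fun x' => F x' (Z ω)) x‖ ^ 2 ∂μ₀ ≤
      ‖gradient (objective μ₀ F Z) x‖ ^ 2 + G := by
  set g := gradient (objective μ₀ F Z) x with hg
  have e : (fun ω => ‖gradient (fun x' => F x' (Z ω)) x‖ ^ 2) = fun ω =>
      ‖gradient (fun x' => F x' (Z ω)) x - g‖ ^ 2
        + 2 * inner ℝ (gradient (fun x' => F x' (Z ω)) x) g - ‖g‖ ^ 2 := by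
    funext ω
    rw [norm_sub_sq_real]; ring
  have hi : Integrable (fun ω => 2 * inner ℝ (gradient (fun x' => F x' (Z ω)) x) g) μ₀ :=
    ((hunb.integrable_grad x).inner_const (𝕜 := ℝ) g).const_mul 2
  have hadd : Integrable (fun ω => ‖gradient (fun x' => F x' (Z ω)) x - g‖ ^ 2
      + 2 * inner ℝ (gradient (fun x' => F x' (Z ω)) x) g) μ₀ := (hunb.integrable_sq x).add hi
  rw [e]
  refine ⟨hadd.sub (integrable_const _), ?_⟩
  rw [integral_sub hadd (integrable_const _),
    integral_add (hunb.integrable_sq x) hi, integral_const_mul, integral_inner_gradient hunb,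
    ← hg, real_inner_self_eq_norm_sq]
  have := hunb.variance_le x
  simp
  linarith

end Objective

/-! ### Random orthogonal directions and the pointwise one-step estimate. -/

section Direction

variable {d l : ℕ} {P : Matrix (Fin d) (Fin l) ℝ} {c : ℝ}

lemma inner_dir_dir (P : Matrix (Fin d) (Fin l) ℝ) (i j : Fin l) :
    inner ℝ (dir P i) (dir P j) = (Pᵀ * P) i j := by
  simp [dir, PiLp.inner_apply, Matrix.mul_apply, mul_comm]

lemma norm_sq_dir (hP : Pᵀ * P = c • (1 : Matrix (Fin l) (Fin l) ℝ)) (i : Fin l) :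
    ‖dir P i‖ ^ 2 = c := by
  rw [← real_inner_self_eq_norm_sq, inner_dir_dir, hP]
  simp

lemma norm_sq_sum_smul_dir (hP : Pᵀ * P = c • (1 : Matrix (Fin l) (Fin l) ℝ)) (a : Fin l → ℝ) :
    ‖∑ i, a i • dir P i‖ ^ 2 = c * ∑ i, a i ^ 2 := by
  rw [← real_inner_self_eq_norm_sq]
  simp_rw [sum_inner, inner_sum, real_inner_smul_left, real_inner_smul_right, inner_dir_dir, hP,
    Matrix.smul_apply, Matrix.one_apply, smul_eq_mul]
  simp only [mul_ite, mul_one, mul_zero, Finset.sum_ite_eq, Finset.mem_univ, if_true,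
    Finset.mul_sum]
  exact Finset.sum_congr rfl fun i _ => by ring

lemma sq_entry_le (hP : Pᵀ * P = c • (1 : Matrix (Fin l) (Fin l) ℝ)) (j : Fin d) (i : Fin l) :
    P j i ^ 2 ≤ c := by
  rw [← norm_sq_dir hP i, EuclideanSpace.norm_sq_eq]
  simp only [dir, Real.norm_eq_abs, sq_abs]
  exact Finset.single_le_sum (f := fun j => P j i ^ 2) (fun _ _ => sq_nonneg _) (Finset.mem_univ j)

variable {Ω : Type*} [MeasurableSpace Ω] {μ : Measure Ω}

lemma measurable_entry {Q : Ω → Matrix (Fin d) (Fin l) ℝ} (hQ : Measurable Q) (j : Fin d)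
    (i : Fin l) : Measurable (fun ω => Q ω j i) :=
  measurable_pi_iff.1 (measurable_pi_iff.1 hQ j) i

/-- In expectation, random directions resolve the inner product. -/
lemma IsDirectionMatrix.integral_sum_inner [IsFiniteMeasure μ] {Q : Ω → Matrix (Fin d) (Fin l) ℝ}
    (hQ : IsDirectionMatrix μ Q) (w v : EuclideanSpace ℝ (Fin d)) :
    Integrable (fun ω => ∑ i, inner ℝ w (dir (Q ω) i) * inner ℝ (dir (Q ω) i) v) μ ∧
    ∫ ω, ∑ i, inner ℝ w (dir (Q ω) i) * inner ℝ (dir (Q ω) i) v ∂μ = inner ℝ w v := by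
  -- The orthogonality relation bounds the entries of `Q` almost surely; this makes the entrywise
  -- expectations genuine integrals rather than default values.
  have hent : ∀ j k, Integrable (fun ω => (Q ω * (Q ω)ᵀ) j k) μ := fun j k => by
    simp only [Matrix.mul_apply, Matrix.transpose_apply]
    refine integrable_finsetSum _ fun i _ => Integrable.of_bound
      ((measurable_entry hQ.measurable j i).mul
        (measurable_entry hQ.measurable k i)).aestronglyMeasurable ((d : ℝ) / l) ?_
    filter_upwards [hQ.orthogonal] with ω hω
    rw [Real.norm_eq_abs, abs_le]
    have h1 := sq_entry_le hω j i
    have h2 := sq_entry_le hω k i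
    constructor <;> nlinarith [sq_nonneg (Q ω j i + Q ω k i), sq_nonneg (Q ω j i - Q ω k i)]
  have e : ∀ ω, ∑ i, inner ℝ w (dir (Q ω) i) * inner ℝ (dir (Q ω) i) v =
      ∑ j, ∑ k, w k * v j * (Q ω * (Q ω)ᵀ) j k := fun ω => by
    simp only [dir, PiLp.inner_apply, Matrix.mul_apply, Matrix.transpose_apply, Finset.mul_sum,
      Finset.sum_mul, RCLike.inner_apply, conj_trivial]
    rw [Finset.sum_comm, Finset.sum_comm' (t' := Finset.univ) (s' := fun _ => Finset.univ)
      (by simp)]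
    rw [Finset.sum_comm]
    refine Finset.sum_congr rfl fun j _ => ?_
    rw [Finset.sum_comm]
    refine Finset.sum_congr rfl fun k _ => Finset.sum_congr rfl fun i _ => by ring
  simp_rw [e]
  refine ⟨integrable_finsetSum _ fun j _ => integrable_finsetSum _ fun k _ =>
    (hent j k).const_mul _, ?_⟩
  rw [integral_finsetSum _ fun j _ => integrable_finsetSum _ fun k _ => (hent j k).const_mul _]
  simp_rw [integral_finsetSum _ fun k _ => (hent _ k).const_mul _, integral_const_mul,
    hQ.expectation, Matrix.one_apply]
  simp [PiLp.inner_apply, mul_comm]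

/-- Pointwise one-step estimate for the squared distance to a reference point. -/
lemma norm_sq_sub_smul_surrogate_le {𝒵 : Type*} {F : EuclideanSpace ℝ (Fin d) → 𝒵 → ℝ} {lam : ℝ}
    (hl : 1 ≤ l) (hsmooth : IsSmooth F lam)
    (hP : Pᵀ * P = ((d : ℝ) / (l : ℝ)) • (1 : Matrix (Fin l) (Fin l) ℝ)) {a h : ℝ} (ha : 0 < a)
    (hh : 0 < h) (x s : EuclideanSpace ℝ (Fin d)) (z : 𝒵) :
    ‖x - a • surrogate F P h x z - s‖ ^ 2 ≤ ‖x - s‖ ^ 2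
      - 2 * a * ∑ i, inner ℝ (gradient (fun x' => F x' z) x) (dir P i) * inner ℝ (dir P i) (x - s)
      + lam * d * √(d : ℝ) / l * (a * h) * ‖x - s‖
      + a ^ 2 * d / l * (2 * ∑ i, inner ℝ (gradient (fun x' => F x' z) x) (dir P i)
          * inner ℝ (dir P i) (gradient (fun x' => F x' z) x)
        + lam ^ 2 * h ^ 2 * (d : ℝ) ^ 2 / (2 * l)) := by
  set w := gradient (fun x' => F x' z) x with hw
  set v := x - s with hv
  have hl0 : (0 : ℝ) < l := by exact_mod_cast hl
  have hlam := hsmooth.pos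
  set c : ℝ := (d : ℝ) / l with hc
  have hc0 : 0 ≤ c := by positivity
  set D : Fin l → ℝ := finiteDiff F P h x z with hD
  set b : Fin l → ℝ := fun i => inner ℝ w (dir P i) with hb
  set ε : Fin l → ℝ := fun i => D i - b i with hε
  -- The Taylor remainder `λ / 2 * h² ‖p‖²`, with `‖p‖² = c`, is divided by `h`.
  have hεb : ∀ i, |ε i| ≤ lam * h * c / 2 := fun i => by
    have h1 := abs_sub_sub_inner_gradient_le (hsmooth.differentiable z) (hsmooth.lipschitz z) x
      (h • dir P i)
    rw [norm_smul, mul_pow, norm_sq_dir hP, Real.norm_of_nonneg hh.le, inner_smul_right] at h1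
    have h2 : ε i = (F (x + h • dir P i) z - F x z - h * inner ℝ w (dir P i)) / h := by
      simp only [hε, hD, hb, finiteDiff]
      field_simp
    rw [h2, abs_div, abs_of_pos hh, div_le_iff₀ hh]
    refine h1.trans (le_of_eq ?_)
    ring
  have hεsq : ∑ i, ε i ^ 2 ≤ l * (lam * h * c / 2) ^ 2 := by
    calc ∑ i, ε i ^ 2 ≤ ∑ _i : Fin l, (lam * h * c / 2) ^ 2 :=
          Finset.sum_le_sum fun i _ => sq_le_sq' (abs_le.1 (hεb i)).1 (abs_le.1 (hεb i)).2
      _ = _ := by simp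
  -- By orthogonality the squared norm is `c ∑ ε_i²`, and `c * l = d`; this is the source of `√d` in
  -- `rho`.
  have he : ‖∑ i, ε i • dir P i‖ ≤ √(d : ℝ) * (lam * h * c / 2) := by
    refine le_of_sq_le_sq ?_ (by positivity)
    rw [norm_sq_sum_smul_dir hP, mul_pow, Real.sq_sqrt (Nat.cast_nonneg d)]
    calc c * ∑ i, ε i ^ 2 ≤ c * (l * (lam * h * c / 2) ^ 2) := by gcongr
      _ = _ := by rw [hc]; field_simp
  have hDsq : ∑ i, D i ^ 2 ≤ 2 * ∑ i, b i * inner ℝ (dir P i) w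
      + lam ^ 2 * h ^ 2 * (d : ℝ) ^ 2 / (2 * l) := by
    have h1 : ∑ i, D i ^ 2 ≤ ∑ i, (2 * (b i * inner ℝ (dir P i) w) + 2 * ε i ^ 2) :=
      Finset.sum_le_sum fun i _ => by
        rw [real_inner_comm w]
        simp only [hε, hb]
        nlinarith [sq_nonneg (2 * inner ℝ w (dir P i) - D i)]
    rw [Finset.sum_add_distrib, ← Finset.mul_sum, ← Finset.mul_sum] at h1
    have h2 : 2 * (l * (lam * h * c / 2) ^ 2) = lam ^ 2 * h ^ 2 * (d : ℝ) ^ 2 / (2 * l) := by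
      rw [hc]; field_simp
    linarith
  have hcross : ∑ i, b i * inner ℝ (dir P i) v - √(d : ℝ) * (lam * h * c / 2) * ‖v‖ ≤
      inner ℝ (∑ i, D i • dir P i) v := by
    have h1 : inner ℝ (∑ i, D i • dir P i) v =
        ∑ i, b i * inner ℝ (dir P i) v + inner ℝ (∑ i, ε i • dir P i) v := by
      simp_rw [sum_inner, real_inner_smul_left, ← Finset.sum_add_distrib]
      exact Finset.sum_congr rfl fun i _ => by simp only [hε]; ring
    have h2 := (abs_le.1 (abs_real_inner_le_norm (∑ i, ε i • dir P i) v)).1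
    have h3 := mul_le_mul_of_nonneg_right he (norm_nonneg v)
    linarith
  have hmain : ‖x - a • surrogate F P h x z - s‖ ^ 2 =
      ‖v‖ ^ 2 - 2 * a * inner ℝ (∑ i, D i • dir P i) v + a ^ 2 * (c * ∑ i, D i ^ 2) := by
    rw [show x - a • surrogate F P h x z - s = v - a • ∑ i, D i • dir P i by
      rw [hv, surrogate]; abel, norm_sub_sq_real, real_inner_smul_right, norm_smul, mul_pow,
      norm_sq_sum_smul_dir hP, Real.norm_of_nonneg ha.le, real_inner_comm v]
    ring
  rw [hmain]
  have h1 := mul_le_mul_of_nonneg_left hcross (by positivity : 0 ≤ 2 * a)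
  have h2 := mul_le_mul_of_nonneg_left hDsq (by positivity : 0 ≤ a ^ 2 * c)
  have h3 : 2 * a * (√(d : ℝ) * (lam * h * c / 2) * ‖v‖)
      = lam * d * √(d : ℝ) / l * (a * h) * ‖v‖ := by rw [hc]; ring
  have h4 : a ^ 2 * c = a ^ 2 * d / l := by rw [hc]; ring
  rw [h4] at h2
  rw [← mul_assoc (a ^ 2) c, h4]
  linarith

end Direction

/-! ### The one-step estimate in expectation. -/

section Step

variable {d l : ℕ} {𝒵 Ω₀ Ω : Type*} [MeasurableSpace Ω₀] [MeasurableSpace Ω]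
  {μ₀ : Measure Ω₀} {μ : Measure Ω}
  {F : EuclideanSpace ℝ (Fin d) → 𝒵 → ℝ} {Z : Ω₀ → 𝒵} {lam G αbar : ℝ} {α h : ℕ → ℝ}

lemma IsStepDisc.Delta_pos (hstep : IsStepDisc d l lam αbar α h) (hl : 1 ≤ l) (hld : l ≤ d)
    (hlam : 0 < lam) : 0 < Delta d l lam αbar := by
  have hl0 : (0 : ℝ) < l := by exact_mod_cast hl
  have hd0 : (0 : ℝ) < d := by exact_mod_cast hl.trans hld
  have h1 := hstep.αbar_lt
  rw [lt_div_iff₀ (by positivity)] at h1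
  rw [Delta, sub_pos, div_lt_div_iff₀ hl0 hlam]
  linarith

/-- The conditional upper bound on the squared distance after one step from `x`. -/
noncomputable def stepBound (l : ℕ) (lam G αbar : ℝ) (α h : ℕ → ℝ)
    (f : EuclideanSpace ℝ (Fin d) → ℝ) (s : EuclideanSpace ℝ (Fin d)) (k : ℕ)
    (x : EuclideanSpace ℝ (Fin d)) : ℝ :=
  ‖x - s‖ ^ 2 + rho d l lam α h k * ‖x - s‖ + noiseTerm d l lam G α h k
    - 2 * lam * Delta d l lam αbar * α k * (f x - f s)

/-- One-step estimate in expectation for the squared distance to a minimizer. -/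
lemma lintegral_step_le [IsProbabilityMeasure μ₀] [IsProbabilityMeasure μ]
    (hl : 1 ≤ l) (hld : l ≤ d) (hFint : ∀ x, Integrable (fun ω => F x (Z ω)) μ₀)
    (hsmooth : IsSmooth F lam) (hunb : IsUnbiasedBounded μ₀ F Z G)
    (hconv : ∀ z, ConvexOn ℝ Set.univ (fun x => F x z))
    (hstep : IsStepDisc d l lam αbar α h) {Q : Ω → Matrix (Fin d) (Fin l) ℝ}
    (hQ : IsDirectionMatrix μ Q) {s : EuclideanSpace ℝ (Fin d)}
    (hs : IsMinOn (objective μ₀ F Z) Set.univ s) (k : ℕ) (x : EuclideanSpace ℝ (Fin d)) :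
    0 ≤ stepBound l lam G αbar α h (objective μ₀ F Z) s k x ∧
    ∫⁻ ω₀, ∫⁻ ω, ENNReal.ofReal (‖x - α k • surrogate F (Q ω) (h k) x (Z ω₀) - s‖ ^ 2) ∂μ ∂μ₀ ≤
      ENNReal.ofReal (stepBound l lam G αbar α h (objective μ₀ F Z) s k x) := by
  have hl0 : (0 : ℝ) < l := by exact_mod_cast hl
  have hd0 : (0 : ℝ) < d := by exact_mod_cast hl.trans hld
  have hαk := hstep.α_pos k
  set g := gradient (objective μ₀ F Z) x with hg
  set w : Ω₀ → EuclideanSpace ℝ (Fin d) := fun ω => gradient (fun x' => F x' (Z ω)) x with hw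
  set R : ℝ := rho d l lam α h k * ‖x - s‖ with hR
  set N : ℝ := lam ^ 2 * h k ^ 2 * (d : ℝ) ^ 2 / (2 * l) with hN
  clear_value R N
  set q : EuclideanSpace ℝ (Fin d) → EuclideanSpace ℝ (Fin d) → Ω → ℝ := fun w v ω =>
    ∑ i, inner ℝ w (dir (Q ω) i) * inner ℝ (dir (Q ω) i) v with hq
  set H : Ω₀ → ℝ := fun ω => ‖x - s‖ ^ 2 - 2 * α k * inner ℝ (w ω) (x - s) + R
      + α k ^ 2 * d / l * (2 * ‖w ω‖ ^ 2 + N) with hH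
  -- The sample is frozen and only the directions are averaged: `q w v` has mean `⟨w, v⟩`.
  -- Nonnegativity is carried along because `ENNReal.ofReal` truncates.
  have hinner : ∀ ω₀, 0 ≤ H ω₀ ∧
      ∫⁻ ω, ENNReal.ofReal (‖x - α k • surrogate F (Q ω) (h k) x (Z ω₀) - s‖ ^ 2) ∂μ ≤
        ENNReal.ofReal (H ω₀) := fun ω₀ => by
    obtain ⟨i1, e1⟩ := hQ.integral_sum_inner (w ω₀) (x - s)
    obtain ⟨i2, e2⟩ := hQ.integral_sum_inner (w ω₀) (w ω₀)
    have j1 : Integrable (fun ω => ‖x - s‖ ^ 2 - 2 * α k * q (w ω₀) (x - s) ω) μ :=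
      (integrable_const _).sub (i1.const_mul _)
    have j2 : Integrable (fun ω => ‖x - s‖ ^ 2 - 2 * α k * q (w ω₀) (x - s) ω + R) μ :=
      j1.add (integrable_const _)
    have j3 : Integrable (fun ω => 2 * q (w ω₀) (w ω₀) ω + N) μ :=
      (i2.const_mul _).add (integrable_const _)
    have j4 : Integrable (fun ω => ‖x - s‖ ^ 2 - 2 * α k * q (w ω₀) (x - s) ω + R
        + α k ^ 2 * d / l * (2 * q (w ω₀) (w ω₀) ω + N)) μ := j2.add (j3.const_mul _)
    have eH : ∫ ω, (‖x - s‖ ^ 2 - 2 * α k * q (w ω₀) (x - s) ω + R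
        + α k ^ 2 * d / l * (2 * q (w ω₀) (w ω₀) ω + N)) ∂μ = H ω₀ := by
      rw [integral_add j2 (j3.const_mul _), integral_add j1 (integrable_const _),
        integral_sub (integrable_const _) (i1.const_mul _), integral_const_mul, integral_const_mul,
        integral_add (i2.const_mul _) (integrable_const _), integral_const_mul, e1, e2,
        real_inner_self_eq_norm_sq]
      simp [hH]
    have hpt : ∀ᵐ ω ∂μ, ‖x - α k • surrogate F (Q ω) (h k) x (Z ω₀) - s‖ ^ 2 ≤
        ‖x - s‖ ^ 2 - 2 * α k * q (w ω₀) (x - s) ω + R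
        + α k ^ 2 * d / l * (2 * q (w ω₀) (w ω₀) ω + N) := by
      filter_upwards [hQ.orthogonal] with ω hω
      rw [hR, hN]
      exact norm_sq_sub_smul_surrogate_le hl hsmooth hω hαk (hstep.h_pos k) x s (Z ω₀)
    have hnn : 0 ≤ᵐ[μ] fun ω => ‖x - s‖ ^ 2 - 2 * α k * q (w ω₀) (x - s) ω + R
        + α k ^ 2 * d / l * (2 * q (w ω₀) (w ω₀) ω + N) := by
      filter_upwards [hpt] with ω hω
      exact (sq_nonneg _).trans hω
    rw [← eH]
    refine ⟨integral_nonneg_of_ae hnn, ?_⟩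
    rw [ofReal_integral_eq_lintegral_ofReal j4 hnn]
    refine lintegral_mono_ae ?_
    filter_upwards [hpt] with ω hω
    exact ENNReal.ofReal_le_ofReal hω
  obtain ⟨k1, e1⟩ := integral_norm_sq_gradient_le hunb x
  have k2 : Integrable (fun ω => inner ℝ (w ω) (x - s)) μ₀ :=
    (hunb.integrable_grad x).inner_const (𝕜 := ℝ) (x - s)
  have j1 : Integrable (fun ω => ‖x - s‖ ^ 2 - 2 * α k * inner ℝ (w ω) (x - s)) μ₀ :=
    (integrable_const _).sub (k2.const_mul _)
  have j2 : Integrable (fun ω => ‖x - s‖ ^ 2 - 2 * α k * inner ℝ (w ω) (x - s) + R) μ₀ :=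
    j1.add (integrable_const _)
  have j3 : Integrable (fun ω => 2 * ‖w ω‖ ^ 2 + N) μ₀ :=
    (k1.const_mul _).add (integrable_const _)
  have j4 : Integrable H μ₀ := j2.add (j3.const_mul _)
  have eH : ∫ ω, H ω ∂μ₀ = ‖x - s‖ ^ 2 - 2 * α k * inner ℝ g (x - s) + R
      + α k ^ 2 * d / l * (2 * ∫ ω, ‖w ω‖ ^ 2 ∂μ₀ + N) := by
    simp only [hH]
    rw [integral_add j2 (j3.const_mul _), integral_add j1 (integrable_const _),
      integral_sub (integrable_const _) (k2.const_mul _), integral_const_mul, integral_const_mul,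
      integral_add (k1.const_mul _) (integrable_const _), integral_const_mul,
      integral_inner_gradient hunb]
    simp only [integral_const, probReal_univ, one_smul]
    rfl
  have hle : ∫ ω, H ω ∂μ₀ ≤ stepBound l lam G αbar α h (objective μ₀ F Z) s k x := by
    have hco := norm_sq_le_mul_inner_of_isMinOn (g := gradient (objective μ₀ F Z)) hsmooth.pos
      (objective_add_inner_le hFint hsmooth hunb hconv)
      (objective_le_add_inner hFint hsmooth hunb) hs x
    have hlow := objective_add_inner_le hFint hsmooth hunb hconv x s
    rw [← neg_sub x s, inner_neg_right] at hlow
    rw [← hg] at hco hlow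
    set I : ℝ := inner ℝ g (x - s) with hI
    have hΔ := hstep.Delta_pos hl hld hsmooth.pos
    have hlam := hsmooth.pos
    -- Cocoercivity bounds the square `‖g‖²` by `λ I`, which forces the sign of `I`.
    have hI0 : 0 ≤ I := by
      by_contra hcon
      have := mul_neg_of_pos_of_neg hlam (not_le.1 hcon)
      nlinarith [sq_nonneg ‖g‖]
    have hA : α k ^ 2 * d / l * (2 * ∫ ω, ‖w ω‖ ^ 2 ∂μ₀ + N) ≤
        α k ^ 2 * d / l * (2 * (lam * I + G) + N) := by
      gcongr
      linarith
    -- One factor `α k` is replaced by `ᾱ`, so that the total coefficient of `I` becomes `-2 λ Δ α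
    -- k`; convexity then trades `I` for the gap in `f`.
    have hB : α k ^ 2 * d / l * (2 * (lam * I)) ≤ αbar * α k * d / l * (2 * (lam * I)) := by
      have := hstep.α_le k
      gcongr
      nlinarith
    have hC : 2 * lam * Delta d l lam αbar * α k * (objective μ₀ F Z x - objective μ₀ F Z s) ≤
        2 * lam * Delta d l lam αbar * α k * I := by
      gcongr
      linarith
    have hD : 2 * lam * Delta d l lam αbar * α k * I =
        2 * α k * I - αbar * α k * d / l * (2 * (lam * I)) := by
      rw [Delta]; field_simp
    rw [eH, stepBound, noiseTerm, ← hN, ← hR]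
    have hE : α k ^ 2 * d / l * (2 * (lam * I + G) + N) =
      α k ^ 2 * d / l * (2 * (lam * I)) + α k ^ 2 * d / l * (N + 2 * G) := by ring
    linarith
  refine ⟨(integral_nonneg fun ω => (hinner ω).1).trans hle, ?_⟩
  calc _ ≤ ∫⁻ ω₀, ENNReal.ofReal (H ω₀) ∂μ₀ := lintegral_mono fun ω₀ => (hinner ω₀).2
    _ = ENNReal.ofReal (∫ ω, H ω ∂μ₀) :=
      (ofReal_integral_eq_lintegral_ofReal j4 (ae_of_all _ fun ω => (hinner ω).1)).symm
    _ ≤ _ := ENNReal.ofReal_le_ofReal hle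

end Step

/-! ### Independence of pairs and the freezing lemma. -/

section Independence

variable {Ω β γ β' γ' : Type*} {m : MeasurableSpace Ω} [mΩ : MeasurableSpace Ω] {μ : Measure Ω} [MeasurableSpace β]
  [MeasurableSpace γ] [MeasurableSpace β'] [MeasurableSpace γ']

/-- Pairing independent random variables taken from two independent groups. -/
lemma indepFun_prodMk_of_indepFun [IsProbabilityMeasure μ] {A : Ω → β} {B : Ω → γ} {C : Ω → β'}
    {D : Ω → γ'} (hA : Measurable A) (hB : Measurable B) (hC : Measurable C) (hD : Measurable D)
    (hAC : IndepFun A C μ) (hBD : IndepFun B D μ)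
    (h : IndepFun (fun ω => (A ω, C ω)) (fun ω => (B ω, D ω)) μ) :
    IndepFun (fun ω => (A ω, B ω)) (fun ω => (C ω, D ω)) μ := by
  refine IndepSets.indep (hA.prodMk hB).comap_le (hC.prodMk hD).comap_le
    (isPiSystem_prod.comap (fun ω => (A ω, B ω))) (isPiSystem_prod.comap (fun ω => (C ω, D ω)))
    ?_ ?_ ?_
  · rw [← generateFrom_prod, MeasurableSpace.comap_generateFrom]
    rfl
  · rw [← generateFrom_prod, MeasurableSpace.comap_generateFrom]
    rfl
  -- Rectangles form a generating π-system. On them the joint probability splits first across the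
  -- two groups, then inside each group; taking full factors in `h` recovers the marginals.
  · rw [IndepSets_iff]
    rintro _ _ ⟨_, ⟨a, ha, b, hb, rfl⟩, rfl⟩ ⟨_, ⟨c, hc, e, he, rfl⟩, rfl⟩
    have hX := hAC.measure_inter_preimage_eq_mul _ _ ha hc
    have hY := hBD.measure_inter_preimage_eq_mul _ _ hb he
    have hAB := h.measure_inter_preimage_eq_mul (a ×ˢ Set.univ) (b ×ˢ Set.univ)
      (ha.prod .univ) (hb.prod .univ)
    have hCD := h.measure_inter_preimage_eq_mul (Set.univ ×ˢ c) (Set.univ ×ˢ e)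
      (.prod .univ hc) (.prod .univ he)
    have hall := h.measure_inter_preimage_eq_mul (a ×ˢ c) (b ×ˢ e) (ha.prod hc) (hb.prod he)
    simp only [Set.mk_preimage_prod, Set.preimage_univ, Set.inter_univ, Set.univ_inter]
      at hAB hCD hall ⊢
    rw [Set.inter_inter_inter_comm, hall, hAB, hCD, hX, hY]
    ring

/-- Freezing lemma: integrating a function of an `m`-measurable variable and of a variable that is
independent of `m`. -/
lemma setLIntegral_eq_of_indep [IsProbabilityMeasure μ]
    (hm : m ≤ mΩ) {W : Ω → β} (hW : Measurable[m] W) {ξ : Ω → γ}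
    (hξ : Measurable ξ) (hind : Indep m (MeasurableSpace.comap ξ inferInstance) μ)
    {φ : β × γ → ENNReal} (hφ : Measurable φ) {A : Set Ω} (hA : MeasurableSet[m] A) :
    ∫⁻ ω in A, φ (W ω, ξ ω) ∂μ = ∫⁻ ω in A, ∫⁻ t, φ (W ω, t) ∂(μ.map ξ) ∂μ := by
  have hW' : Measurable W := hW.mono hm le_rfl
  have : IsProbabilityMeasure (μ.map ξ) := Measure.isProbabilityMeasure_map hξ.aemeasurable
  -- Restricting to `A` preserves the product structure because `A` and `W` both live in `m`, which
  -- is independent of `ξ`.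
  have hmap : ((μ.restrict A).map W).prod (μ.map ξ) = (μ.restrict A).map fun ω => (W ω, ξ ω) := by
    refine Measure.prod_eq fun s t hs ht => ?_
    rw [Measure.map_apply (hW'.prodMk hξ) (hs.prod ht), Measure.map_apply hW' hs,
      Measure.map_apply hξ ht, Measure.restrict_apply (hW' hs),
      Measure.restrict_apply ((hW'.prodMk hξ) (hs.prod ht)), Set.mk_preimage_prod,
      Set.inter_right_comm]
    exact (Indep_iff _ _ _).1 hind _ _ (MeasurableSet.inter (hW hs) hA) ⟨t, ht, rfl⟩
  rw [← lintegral_map hφ (hW'.prodMk hξ), ← hmap, lintegral_prod _ hφ.aemeasurable,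
    lintegral_map (Measurable.lintegral_prod_right' hφ) hW']

end Independence

/-! ### The filtration of the past. -/

section History

variable {Ω M 𝒵 : Type*} [mΩ : MeasurableSpace Ω] [MeasurableSpace M] [MeasurableSpace 𝒵]
  {μ : Measure Ω}

/-- The first `k` values of two sequences of random variables. -/
def history (P : ℕ → Ω → M) (Zs : ℕ → Ω → 𝒵) (k : ℕ) (ω : Ω) :
    (Finset.range k → M) × (Finset.range k → 𝒵) :=
  (fun i => P i ω, fun i => Zs i ω)

/-- The filtration generated by the past of two sequences of random variables. -/
def historyFiltration {P : ℕ → Ω → M} {Zs : ℕ → Ω → 𝒵} (hP : ∀ k, Measurable (P k))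
    (hZs : ∀ k, Measurable (Zs k)) : Filtration ℕ mΩ where
  -- Only indices below `k` enter: `x_k` is determined by them, while `(P_k, Z_k)` is still fresh.
  seq k := MeasurableSpace.comap (history P Zs k) inferInstance
  mono' i j hij := by
    have hsub : ∀ n : Finset.range i, n.1 ∈ Finset.range j := fun n =>
      Finset.range_mono hij n.2
    have hr : Measurable (fun p : (Finset.range j → M) × (Finset.range j → 𝒵) =>
        ((fun n : Finset.range i => p.1 ⟨n, hsub n⟩, fun n : Finset.range i => p.2 ⟨n, hsub n⟩) :
          (Finset.range i → M) × (Finset.range i → 𝒵))) := by fun_prop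
    exact (hr.comp (comap_measurable (history P Zs j))).comap_le
  le' k := Measurable.comap_le (by unfold history; fun_prop)

variable {P : ℕ → Ω → M} {Zs : ℕ → Ω → 𝒵} (hP : ∀ k, Measurable (P k))
  (hZs : ∀ k, Measurable (Zs k))

lemma measurable_historyFiltration_succ (k : ℕ) :
    Measurable[historyFiltration hP hZs (k + 1)] fun ω => (P k ω, Zs k ω) := by
  have hk : k ∈ Finset.range (k + 1) := by simp
  have hr : Measurable (fun p : (Finset.range (k + 1) → M) × (Finset.range (k + 1) → 𝒵) =>
      (p.1 ⟨k, hk⟩, p.2 ⟨k, hk⟩)) := by fun_prop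
  exact hr.comp (comap_measurable (history P Zs (k + 1)))

/-- Past and present are independent within each sequence, and the two sequences are independent of
each other; regrouping turns this into independence of the joint past from the joint present. -/
lemma indep_historyFiltration [IsProbabilityMeasure μ] (hPindep : iIndepFun P μ)
    (hZindep : iIndepFun Zs μ) (hPZ : IndepFun (fun ω k => P k ω) (fun ω k => Zs k ω) μ) (k : ℕ) :
    Indep (historyFiltration hP hZs k)
      (MeasurableSpace.comap (fun ω => (P k ω, Zs k ω)) inferInstance) μ := by
  have hd : Disjoint (Finset.range k) {k} := by simp
  have hk : k ∈ ({k} : Finset ℕ) := Finset.mem_singleton_self k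
  refine indepFun_prodMk_of_indepFun (A := fun ω (i : Finset.range k) => P i ω)
    (B := fun ω (i : Finset.range k) => Zs i ω) (C := P k) (D := Zs k)
    (by fun_prop) (by fun_prop) (hP k) (hZs k) ?_ ?_ ?_
  · exact (hPindep.indepFun_finset _ _ hd hP).comp measurable_id
      (measurable_pi_apply (⟨k, hk⟩ : ({k} : Finset ℕ)))
  · exact (hZindep.indepFun_finset _ _ hd hZs).comp measurable_id
      (measurable_pi_apply (⟨k, hk⟩ : ({k} : Finset ℕ)))
  · exact hPZ.comp (φ := fun p : ℕ → M => ((fun i : Finset.range k => p i), p k))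
      (ψ := fun p : ℕ → 𝒵 => ((fun i : Finset.range k => p i), p k)) (by fun_prop) (by fun_prop)

end History

/-! ### Measurability of the iterates and the conditional recursion. -/

section Iterate

variable {d l : ℕ} {𝒵 Ω₀ Ω : Type*} [MeasurableSpace 𝒵] [MeasurableSpace Ω₀]
  [mΩ : MeasurableSpace Ω] {μ₀ : Measure Ω₀} {μ : Measure Ω}
  {F : EuclideanSpace ℝ (Fin d) → 𝒵 → ℝ} {Z : Ω₀ → 𝒵} {lam G αbar : ℝ} {α h : ℕ → ℝ}

lemma measurable_dir (i : Fin l) :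
    Measurable (fun P : Matrix (Fin d) (Fin l) ℝ => dir P i) := by
  refine (WithLp.measurable_toLp 2 (Fin d → ℝ)).comp (measurable_pi_iff.2 fun j => ?_)
  exact measurable_entry measurable_id j i

/-- `F` is a Carathéodory function: continuous in `x`, measurable in `z`. -/
lemma measurable_uncurry_of_isSmooth (hFmeas : ∀ x, Measurable (F x)) (hsmooth : IsSmooth F lam) :
    Measurable (Function.uncurry F) :=
  measurable_uncurry_of_continuous_of_measurable
    (fun z => (hsmooth.differentiable z).continuous) hFmeas

lemma measurable_surrogate (hFmeas : ∀ x, Measurable (F x)) (hsmooth : IsSmooth F lam) (h : ℝ) :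
    Measurable fun t : EuclideanSpace ℝ (Fin d) × Matrix (Fin d) (Fin l) ℝ × 𝒵 =>
      surrogate F t.2.1 h t.1 t.2.2 := by
  have hF := measurable_uncurry_of_isSmooth hFmeas hsmooth
  unfold surrogate finiteDiff
  refine Finset.measurable_sum _ fun i _ => ?_
  have hdir : Measurable fun t : EuclideanSpace ℝ (Fin d) × Matrix (Fin d) (Fin l) ℝ × 𝒵 =>
      dir t.2.1 i := (measurable_dir i).comp measurable_snd.fst
  refine Measurable.smul (Measurable.div_const (Measurable.sub ?_ ?_) h) hdir
  · exact hF.comp ((measurable_fst.add (hdir.const_smul h)).prodMk measurable_snd.snd)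
  · exact hF.comp (measurable_fst.prodMk measurable_snd.snd)

variable {P : ℕ → Ω → Matrix (Fin d) (Fin l) ℝ} {Zs : ℕ → Ω → 𝒵}

lemma measurable_iterate (hFmeas : ∀ x, Measurable (F x)) (hsmooth : IsSmooth F lam)
    (hP : ∀ k, Measurable (P k)) (hZs : ∀ k, Measurable (Zs k))
    (x₀ : EuclideanSpace ℝ (Fin d)) (k : ℕ) :
    Measurable[historyFiltration hP hZs k] (iterate F α h x₀ P Zs k) := by
  induction k with
  | zero => exact measurable_const
  | succ k ih =>
    have h1 := ih.mono ((historyFiltration hP hZs).mono k.le_succ) le_rfl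
    have h2 := (measurable_surrogate hFmeas hsmooth (h k)).comp
      (h1.prodMk (measurable_historyFiltration_succ hP hZs k))
    exact Measurable.sub h1 (Measurable.const_smul h2 (α k))

/-- Testing on every event of the past expresses the conditional inequality without conditional
expectations. Freezing `x_k` reduces it to `lintegral_step_le`, since `(P_k, Z_k)` has a product law
whose second factor is the law of `Z`. -/
lemma setLIntegral_norm_sq_iterate_succ_le [IsProbabilityMeasure μ₀] [IsProbabilityMeasure μ]
    (hl : 1 ≤ l) (hld : l ≤ d) (hZ : Measurable Z) (hFmeas : ∀ x, Measurable (F x))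
    (hFint : ∀ x, Integrable (fun ω => F x (Z ω)) μ₀)
    (hsmooth : IsSmooth F lam) (hunb : IsUnbiasedBounded μ₀ F Z G)
    (hconv : ∀ z, ConvexOn ℝ Set.univ (fun x => F x z))
    (hstep : IsStepDisc d l lam αbar α h) (hZs : ∀ k, Measurable (Zs k))
    (hZcopy : ∀ k, IdentDistrib (Zs k) Z μ μ₀) (hZindep : iIndepFun Zs μ)
    (hP : ∀ k, IsDirectionMatrix μ (P k)) (hPindep : iIndepFun P μ)
    (hPZ : IndepFun (fun ω k => P k ω) (fun ω k => Zs k ω) μ)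
    (x₀ : EuclideanSpace ℝ (Fin d)) {s : EuclideanSpace ℝ (Fin d)}
    (hs : IsMinOn (objective μ₀ F Z) Set.univ s) (k : ℕ) {A : Set Ω}
    (hA : MeasurableSet[historyFiltration (fun k => (hP k).measurable) hZs k] A) :
    ∫⁻ ω in A, ENNReal.ofReal (‖iterate F α h x₀ P Zs (k + 1) ω - s‖ ^ 2) ∂μ ≤
      ∫⁻ ω in A, ENNReal.ofReal (stepBound l lam G αbar α h (objective μ₀ F Z) s k
        (iterate F α h x₀ P Zs k ω)) ∂μ := by
  have hPm : ∀ k, Measurable (P k) := fun k => (hP k).measurable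
  have hξ : Measurable fun ω => (P k ω, Zs k ω) := (hPm k).prodMk (hZs k)
  have hφ : Measurable fun t : EuclideanSpace ℝ (Fin d) × Matrix (Fin d) (Fin l) ℝ × 𝒵 =>
      ENNReal.ofReal (‖t.1 - α k • surrogate F t.2.1 (h k) t.1 t.2.2 - s‖ ^ 2) :=
    (((measurable_fst.sub ((measurable_surrogate hFmeas hsmooth (h k)).const_smul (α k))).sub_const
      s).norm.pow_const 2).ennreal_ofReal
  have hlaw : μ.map (fun ω => (P k ω, Zs k ω)) = (μ.map (P k)).prod (μ₀.map Z) := by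
    rw [← (hZcopy k).map_eq]
    exact (indepFun_iff_map_prod_eq_prod_map_map (hPm k).aemeasurable (hZs k).aemeasurable).1
      (hPZ.comp (measurable_pi_apply k) (measurable_pi_apply k))
  have := Measure.isProbabilityMeasure_map (μ := μ) (hPm k).aemeasurable
  have := Measure.isProbabilityMeasure_map (μ := μ₀) hZ.aemeasurable
  refine (setLIntegral_eq_of_indep ((historyFiltration hPm hZs).le k)
    (measurable_iterate hFmeas hsmooth hPm hZs x₀ k) hξ
    (indep_historyFiltration hPm hZs hPindep hZindep hPZ k) hφ hA).trans_le ?_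
  refine lintegral_mono fun ω => ?_
  have hφω := hφ.comp (measurable_prodMk_left (x := iterate F α h x₀ P Zs k ω))
  rw [hlaw]
  refine (lintegral_prod_symm' _ hφω).trans_le ?_
  rw [lintegral_map (Measurable.lintegral_prod_left' hφω) hZ]
  refine le_trans (le_of_eq (lintegral_congr fun ω₀ => ?_))
    (lintegral_step_le hl hld hFint hsmooth hunb hconv hstep (hP k) hs k _).2
  exact lintegral_map (hφω.comp measurable_prodMk_right) (hPm k)

end Iterate

/-! ### A deterministic Grönwall bound. -/

section Deterministic

/-- A Grönwall-type bound for square-root perturbed quadratic recursions. -/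
lemma le_sqrt_add_sum_of_sq_succ_le {a ρ n : ℕ → ℝ} {S : ℝ} (hρ : ∀ k, 0 ≤ ρ k)
    (hS : ∀ k, a 0 ^ 2 + ∑ i ∈ Finset.range k, n i ≤ S)
    (hrec : ∀ k, a (k + 1) ^ 2 ≤ a k ^ 2 + ρ k * a k + n k) (k : ℕ) :
    a k ≤ √S + ∑ i ∈ Finset.range k, ρ i := by
  have htel : ∀ k, a k ^ 2 ≤ a 0 ^ 2 + ∑ i ∈ Finset.range k, n i
      + ∑ i ∈ Finset.range k, ρ i * a i := fun k => by
    induction k with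
    | zero => simp
    | succ k ih =>
      rw [Finset.sum_range_succ, Finset.sum_range_succ]
      linarith [hrec k]
  have hS0 : 0 ≤ S := by
    have := hS 0
    simp only [Finset.range_zero, Finset.sum_empty, add_zero] at this
    exact (sq_nonneg _).trans this
  induction k using Nat.strong_induction_on with
  | _ k ih =>
    set R := ∑ i ∈ Finset.range k, ρ i with hR
    have hR0 : 0 ≤ R := Finset.sum_nonneg fun i _ => hρ i
    refine le_of_sq_le_sq ?_ (by positivity)
    -- Earlier terms satisfy `a i ≤ √S + R`, so `a k ^ 2 ≤ S + R (√S + R) ≤ (√S + R) ^ 2`.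
    have h1 : ∑ i ∈ Finset.range k, ρ i * a i ≤ R * (√S + R) := by
      rw [hR, Finset.sum_mul]
      refine Finset.sum_le_sum fun i hi => mul_le_mul_of_nonneg_left ?_ (hρ i)
      have hik := Finset.mem_range.1 hi
      refine (ih i hik).trans (add_le_add_right ?_ _)
      exact Finset.sum_le_sum_of_subset_of_nonneg (Finset.range_mono hik.le) fun j _ _ => hρ j
    have h2 := htel k
    have h3 := hS k
    have h4 := Real.sq_sqrt hS0
    nlinarith [mul_nonneg hR0 (Real.sqrt_nonneg S)]

end Deterministic

/-! ### Stochastic quasi-Fejér processes. -/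

section QuasiFejer

variable {Ω : Type*} [mΩ : MeasurableSpace Ω] {μ : Measure Ω}

/-- A series of nonnegative random variables with bounded expected partial sums converges almost
surely. -/
lemma ae_summable_of_sum_integral_le {f : ℕ → Ω → ℝ} (hf : ∀ k, Integrable (f k) μ)
    (h0 : ∀ k ω, 0 ≤ f k ω) {C : ℝ} (hC : ∀ k, ∑ i ∈ Finset.range k, ∫ ω, f i ω ∂μ ≤ C) :
    ∀ᵐ ω ∂μ, Summable fun k => f k ω := by
  have hs : Summable fun k => ∫ ω, f k ω ∂μ :=
    summable_of_sum_range_le (fun k => integral_nonneg (h0 k)) hC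
  have hfin : ∫⁻ ω, ∑' k, ENNReal.ofReal (f k ω) ∂μ ≠ ⊤ := by
    rw [lintegral_tsum fun k => (hf k).aemeasurable.ennreal_ofReal]
    simp_rw [← ofReal_integral_eq_lintegral_ofReal (hf _) (ae_of_all _ (h0 _))]
    exact hs.tsum_ofReal_ne_top
  filter_upwards [ae_lt_top' (AEMeasurable.tsum fun k =>
    (hf k).aemeasurable.ennreal_ofReal) hfin] with ω hω
  refine (ENNReal.summable_toReal hω.ne).congr fun k => ?_
  rw [ENNReal.toReal_ofReal (h0 k ω)]

/-- A stochastic quasi-Fejér process: `r` is the distance to a target, which up to perturbations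
`ρ`, `n` decreases in conditional mean square by at least `γ * δ`. -/
structure IsQuasiFejer (μ : Measure Ω) (ℱ : Filtration ℕ mΩ) (r δ : ℕ → Ω → ℝ)
    (ρ n γ : ℕ → ℝ) : Prop where
  measurable_dist : ∀ k, Measurable[ℱ k] (r k)
  measurable_gap : ∀ k, Measurable[ℱ k] (δ k)
  dist_nonneg : ∀ k ω, 0 ≤ r k ω
  gap_nonneg : ∀ k ω, 0 ≤ δ k ω
  ρ_nonneg : ∀ k, 0 ≤ ρ k
  n_nonneg : ∀ k, 0 ≤ n k
  γ_nonneg : ∀ k, 0 ≤ γ k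
  gap_le : ∃ K, ∀ k ω, δ k ω ≤ K * r k ω ^ 2
  integrable_zero : Integrable (fun ω => r 0 ω ^ 2) μ
  bound_nonneg : ∀ k ω, 0 ≤ r k ω ^ 2 + ρ k * r k ω + n k - γ k * δ k ω
  step : ∀ k A, MeasurableSet[ℱ k] A → ∫⁻ ω in A, ENNReal.ofReal (r (k + 1) ω ^ 2) ∂μ ≤
    ∫⁻ ω in A, ENNReal.ofReal (r k ω ^ 2 + ρ k * r k ω + n k - γ k * δ k ω) ∂μ

namespace IsQuasiFejer

variable {ℱ : Filtration ℕ mΩ} {r δ : ℕ → Ω → ℝ} {ρ n γ : ℕ → ℝ}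

/-- The quadratic bound `gap_le` spares a separate integrability assumption on the gap. -/
lemma integrable_gap_of_sq (H : IsQuasiFejer μ ℱ r δ ρ n γ) {k : ℕ}
    (hk : Integrable (fun ω => r k ω ^ 2) μ) : Integrable (δ k) μ := by
  obtain ⟨K, hK⟩ := H.gap_le
  refine Integrable.mono' (hk.const_mul K)
    ((H.measurable_gap k).mono (ℱ.le k) le_rfl).aestronglyMeasurable (ae_of_all _ fun ω => ?_)
  rw [Real.norm_of_nonneg (H.gap_nonneg k ω)]
  exact hK k ω

lemma integral_gap_nonneg (H : IsQuasiFejer μ ℱ r δ ρ n γ) (k : ℕ) : 0 ≤ ∫ ω, δ k ω ∂μ :=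
  integral_nonneg (H.gap_nonneg k)

variable [IsProbabilityMeasure μ]

lemma integrable_dist_of_sq (H : IsQuasiFejer μ ℱ r δ ρ n γ) {k : ℕ}
    (hk : Integrable (fun ω => r k ω ^ 2) μ) : Integrable (r k) μ := by
  refine Integrable.mono' ((integrable_const 1).add hk)
    ((H.measurable_dist k).mono (ℱ.le k) le_rfl).aestronglyMeasurable (ae_of_all _ fun ω => ?_)
  rw [Real.norm_of_nonneg (H.dist_nonneg k ω)]
  simp only [Pi.add_apply]
  nlinarith [sq_nonneg (r k ω - 1)]

lemma integrable_bound_of_sq (H : IsQuasiFejer μ ℱ r δ ρ n γ) {k : ℕ}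
    (hk : Integrable (fun ω => r k ω ^ 2) μ) :
    Integrable (fun ω => r k ω ^ 2 + ρ k * r k ω + n k - γ k * δ k ω) μ :=
  ((hk.add ((H.integrable_dist_of_sq hk).const_mul _)).add (integrable_const _)).sub
    ((H.integrable_gap_of_sq hk).const_mul _)

/-- The recursion is stated with Lebesgue integrals and so makes sense before integrability is
known; it then propagates finiteness from step to step. -/
lemma integrable_sq (H : IsQuasiFejer μ ℱ r δ ρ n γ) (k : ℕ) :
    Integrable (fun ω => r k ω ^ 2) μ := by
  induction k with
  | zero => exact H.integrable_zero
  | succ k ih =>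
    have h := H.step k Set.univ MeasurableSet.univ
    rw [Measure.restrict_univ] at h
    refine ⟨(((H.measurable_dist (k + 1)).mono (ℱ.le _) le_rfl).pow_const 2).aestronglyMeasurable,
      ?_⟩
    rw [hasFiniteIntegral_iff_ofReal (ae_of_all _ fun ω => sq_nonneg _)]
    refine h.trans_lt ?_
    rw [← hasFiniteIntegral_iff_ofReal (ae_of_all _ (H.bound_nonneg k))]
    exact (H.integrable_bound_of_sq ih).2

lemma integrable_dist (H : IsQuasiFejer μ ℱ r δ ρ n γ) (k : ℕ) : Integrable (r k) μ :=
  H.integrable_dist_of_sq (H.integrable_sq k)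

lemma integrable_gap (H : IsQuasiFejer μ ℱ r δ ρ n γ) (k : ℕ) : Integrable (δ k) μ :=
  H.integrable_gap_of_sq (H.integrable_sq k)

lemma setIntegral_succ_le (H : IsQuasiFejer μ ℱ r δ ρ n γ) (k : ℕ) {A : Set Ω}
    (hA : MeasurableSet[ℱ k] A) : ∫ ω in A, r (k + 1) ω ^ 2 ∂μ ≤
      ∫ ω in A, (r k ω ^ 2 + ρ k * r k ω + n k - γ k * δ k ω) ∂μ := by
  have hb := (H.integrable_bound_of_sq (H.integrable_sq k)).restrict (s := A)
  rw [← ENNReal.ofReal_le_ofReal_iff (integral_nonneg fun ω => H.bound_nonneg k ω),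
    ofReal_integral_eq_lintegral_ofReal (H.integrable_sq (k + 1)).restrict
      (ae_of_all _ fun ω => sq_nonneg _),
    ofReal_integral_eq_lintegral_ofReal hb (ae_of_all _ (H.bound_nonneg k))]
  exact H.step k A hA

lemma integral_succ_le (H : IsQuasiFejer μ ℱ r δ ρ n γ) (k : ℕ) :
    ∫ ω, r (k + 1) ω ^ 2 ∂μ ≤ ∫ ω, r k ω ^ 2 ∂μ + ρ k * ∫ ω, r k ω ∂μ + n k
      - γ k * ∫ ω, δ k ω ∂μ := by
  have h := H.setIntegral_succ_le k (A := Set.univ) MeasurableSet.univ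
  have i1 := (H.integrable_dist k).const_mul (ρ k)
  have i2 : Integrable (fun ω => r k ω ^ 2 + ρ k * r k ω) μ := (H.integrable_sq k).add i1
  have i3 : Integrable (fun ω => r k ω ^ 2 + ρ k * r k ω + n k) μ := i2.add (integrable_const _)
  rw [setIntegral_univ, setIntegral_univ, integral_sub i3 ((H.integrable_gap k).const_mul _),
    integral_add i2 (integrable_const _), integral_add (H.integrable_sq k) i1,
    integral_const_mul, integral_const_mul, integral_const, probReal_univ, one_smul] at h
  exact h

lemma integral_dist_le_sqrt (H : IsQuasiFejer μ ℱ r δ ρ n γ) (k : ℕ) :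
    ∫ ω, r k ω ∂μ ≤ √(∫ ω, r k ω ^ 2 ∂μ) := by
  refine Real.le_sqrt_of_sq_le ?_
  set m := ∫ ω, r k ω ∂μ with hm
  have h : 0 ≤ ∫ ω, (r k ω - m) ^ 2 ∂μ := integral_nonneg fun ω => sq_nonneg _
  have e : ∀ ω, (r k ω - m) ^ 2 = r k ω ^ 2 - 2 * m * r k ω + m ^ 2 := fun ω => by ring
  have i1 := (H.integrable_dist k).const_mul (2 * m)
  have i2 : Integrable (fun ω => r k ω ^ 2 - 2 * m * r k ω) μ := (H.integrable_sq k).sub i1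
  simp_rw [e] at h
  rw [integral_add i2 (integrable_const _), integral_sub (H.integrable_sq k) i1,
    integral_const_mul, integral_const, probReal_univ, one_smul, ← hm] at h
  nlinarith

variable {S : ℝ}

/-- The Grönwall bound applied to the `L²` norms of `r k`: the linear perturbation involves the mean
of `r k`, which is at most its `L²` norm. -/
lemma sqrt_integral_sq_le (H : IsQuasiFejer μ ℱ r δ ρ n γ)
    (hS : ∀ k, ∫ ω, r 0 ω ^ 2 ∂μ + ∑ i ∈ Finset.range k, n i ≤ S) (k : ℕ) :
    √(∫ ω, r k ω ^ 2 ∂μ) ≤ √S + ∑ i ∈ Finset.range k, ρ i := by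
  have hsq : ∀ k, √(∫ ω, r k ω ^ 2 ∂μ) ^ 2 = ∫ ω, r k ω ^ 2 ∂μ := fun k =>
    Real.sq_sqrt (integral_nonneg fun ω => sq_nonneg _)
  refine le_sqrt_add_sum_of_sq_succ_le (a := fun k => √(∫ ω, r k ω ^ 2 ∂μ)) (n := n)
    H.ρ_nonneg (fun k => ?_) (fun k => ?_) k
  · rw [hsq]
    exact hS k
  · rw [hsq, hsq]
    have h1 := H.integral_succ_le k
    have h2 := mul_le_mul_of_nonneg_left (H.integral_dist_le_sqrt k) (H.ρ_nonneg k)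
    have h3 := mul_nonneg (H.γ_nonneg k) (H.integral_gap_nonneg k)
    linarith

lemma integral_dist_le (H : IsQuasiFejer μ ℱ r δ ρ n γ)
    (hS : ∀ k, ∫ ω, r 0 ω ^ 2 ∂μ + ∑ i ∈ Finset.range k, n i ≤ S) (k : ℕ) :
    ∫ ω, r k ω ∂μ ≤ √S + ∑ i ∈ Finset.range k, ρ i :=
  (H.integral_dist_le_sqrt k).trans (H.sqrt_integral_sq_le hS k)

lemma sum_integral_gap_le (H : IsQuasiFejer μ ℱ r δ ρ n γ)
    (hS : ∀ k, ∫ ω, r 0 ω ^ 2 ∂μ + ∑ i ∈ Finset.range k, n i ≤ S) (k : ℕ) :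
    ∑ i ∈ Finset.range k, γ i * ∫ ω, δ i ω ∂μ ≤
      S + ∑ i ∈ Finset.range k, ρ i * (√S + ∑ j ∈ Finset.range (i + 1), ρ j) := by
  have htel : ∀ k, ∫ ω, r k ω ^ 2 ∂μ + ∑ i ∈ Finset.range k, γ i * ∫ ω, δ i ω ∂μ ≤
      ∫ ω, r 0 ω ^ 2 ∂μ + ∑ i ∈ Finset.range k, n i
        + ∑ i ∈ Finset.range k, ρ i * ∫ ω, r i ω ∂μ := fun k => by
    induction k with
    | zero => simp
    | succ k ih =>
      simp only [Finset.sum_range_succ]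
      linarith [H.integral_succ_le k]
  have h1 : ∑ i ∈ Finset.range k, ρ i * ∫ ω, r i ω ∂μ ≤
      ∑ i ∈ Finset.range k, ρ i * (√S + ∑ j ∈ Finset.range (i + 1), ρ j) := by
    refine Finset.sum_le_sum fun i _ => mul_le_mul_of_nonneg_left ?_ (H.ρ_nonneg i)
    refine (H.integral_dist_le hS i).trans ?_
    -- The available bound stops at `j < i`; the nonnegative term `ρ i` is added to reach the
    -- inclusive sum used in `driftTerm`.
    rw [Finset.sum_range_succ]
    linarith [H.ρ_nonneg i]
  have h2 : 0 ≤ ∫ ω, r k ω ^ 2 ∂μ := integral_nonneg fun ω => sq_nonneg _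
  linarith [htel k, hS k]

lemma bounds (H : IsQuasiFejer μ ℱ r δ ρ n γ) (hρ : Summable ρ) (hn : Summable n) :
    ∃ B C, (∀ k, ∫ ω, r k ω ^ 2 ∂μ ≤ B) ∧
      (∀ k, ∑ i ∈ Finset.range k, ∫ ω, ρ i * r i ω ∂μ ≤ C) ∧
      (∀ k, ∑ i ∈ Finset.range k, ∫ ω, γ i * δ i ω ∂μ ≤ C) := by
  set S := ∫ ω, r 0 ω ^ 2 ∂μ + ∑' i, n i with hSdef
  have hS : ∀ k, ∫ ω, r 0 ω ^ 2 ∂μ + ∑ i ∈ Finset.range k, n i ≤ S := fun k =>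
    add_le_add_right (hn.sum_le_tsum _ fun i _ => H.n_nonneg i) _
  set T := √S + ∑' i, ρ i with hT
  have hle : ∀ k, √S + ∑ i ∈ Finset.range k, ρ i ≤ T := fun k =>
    add_le_add_right (hρ.sum_le_tsum _ fun i _ => H.ρ_nonneg i) _
  have hT0 : 0 ≤ T := add_nonneg (Real.sqrt_nonneg _) (tsum_nonneg H.ρ_nonneg)
  have hS0 : 0 ≤ S := add_nonneg (integral_nonneg fun ω => sq_nonneg _) (tsum_nonneg H.n_nonneg)
  have hsum : ∀ k, ∑ i ∈ Finset.range k, ρ i * T ≤ (∑' i, ρ i) * T := fun k => by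
    rw [← Finset.sum_mul]
    exact mul_le_mul_of_nonneg_right (hρ.sum_le_tsum _ fun i _ => H.ρ_nonneg i) hT0
  refine ⟨T ^ 2, S + (∑' i, ρ i) * T, fun k => ?_, fun k => ?_, fun k => ?_⟩
  · exact Real.sqrt_le_left hT0 |>.1 ((H.sqrt_integral_sq_le hS k).trans (hle k))
  · simp_rw [integral_const_mul]
    have : ∑ i ∈ Finset.range k, ρ i * ∫ ω, r i ω ∂μ ≤ ∑ i ∈ Finset.range k, ρ i * T :=
      Finset.sum_le_sum fun i _ => mul_le_mul_of_nonneg_left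
        ((H.integral_dist_le hS i).trans (hle i)) (H.ρ_nonneg i)
    linarith [hsum k]
  · simp_rw [integral_const_mul]
    have : ∑ i ∈ Finset.range k, ρ i * (√S + ∑ j ∈ Finset.range (i + 1), ρ j) ≤
        ∑ i ∈ Finset.range k, ρ i * T :=
      Finset.sum_le_sum fun i _ => mul_le_mul_of_nonneg_left (hle _) (H.ρ_nonneg i)
    linarith [hsum k, H.sum_integral_gap_le hS k]

lemma ae_summable_gap (H : IsQuasiFejer μ ℱ r δ ρ n γ) (hρ : Summable ρ) (hn : Summable n) :
    ∀ᵐ ω ∂μ, Summable fun k => γ k * δ k ω := by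
  obtain ⟨_, _, _, _, hC⟩ := H.bounds hρ hn
  exact ae_summable_of_sum_integral_le (fun k => (H.integrable_gap k).const_mul _)
    (fun k ω => mul_nonneg (H.γ_nonneg k) (H.gap_nonneg k ω)) hC

/-- Conditionally on the past, the increment is at least `γ k * δ k ≥ 0`: the compensating sum
offsets exactly the perturbations allowed in `r k ^ 2`. -/
lemma submartingale (H : IsQuasiFejer μ ℱ r δ ρ n γ) :
    Submartingale (fun k ω => ∑ i ∈ Finset.range k, (ρ i * r i ω + n i) - r k ω ^ 2) ℱ μ := by
  have hi : ∀ i, Integrable (fun ω => ρ i * r i ω + n i) μ := fun i =>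
    ((H.integrable_dist i).const_mul _).add (integrable_const _)
  have hI : ∀ k, Integrable (fun ω => ∑ i ∈ Finset.range k, (ρ i * r i ω + n i)) μ := fun k =>
    integrable_finsetSum _ fun i _ => hi i
  refine submartingale_of_setIntegral_le_succ (fun k => ?_)
    (fun k => (hI k).sub (H.integrable_sq k)) (fun k A hA => ?_)
  · refine Measurable.stronglyMeasurable (Measurable.sub (Finset.measurable_sum _ fun i hi => ?_)
      ((H.measurable_dist k).pow_const 2))
    exact (((H.measurable_dist i).mono (ℱ.mono (Finset.mem_range.1 hi).le) le_rfl).const_mul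
      _).add_const _
  · have h := H.setIntegral_succ_le k hA
    have hb : ∫ ω in A, (r k ω ^ 2 + ρ k * r k ω + n k - γ k * δ k ω) ∂μ ≤
        ∫ ω in A, (r k ω ^ 2 + (ρ k * r k ω + n k)) ∂μ :=
      integral_mono (H.integrable_bound_of_sq (H.integrable_sq k)).restrict
        ((H.integrable_sq k).add (hi k)).restrict fun ω => by
          have := mul_nonneg (H.γ_nonneg k) (H.gap_nonneg k ω)
          simp only
          linarith
    rw [integral_add (H.integrable_sq k).restrict (hi k).restrict] at hb
    rw [integral_sub (hI k).restrict (H.integrable_sq k).restrict,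
      integral_sub (hI (k + 1)).restrict (H.integrable_sq (k + 1)).restrict]
    simp_rw [Finset.sum_range_succ]
    rw [integral_add (hI k).restrict (hi k).restrict]
    linarith

/-- Doob's theorem gives convergence of the compensated process. Its compensator also converges
almost surely, so `r k ^ 2` does, and then `r k`. -/
lemma ae_exists_tendsto_dist (H : IsQuasiFejer μ ℱ r δ ρ n γ) (hρ : Summable ρ)
    (hn : Summable n) : ∀ᵐ ω ∂μ, ∃ c, Tendsto (fun k => r k ω) atTop (𝓝 c) := by
  obtain ⟨B, C, hB, hC, -⟩ := H.bounds hρ hn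
  have hi : ∀ i, Integrable (fun ω => ρ i * r i ω + n i) μ := fun i =>
    ((H.integrable_dist i).const_mul _).add (integrable_const _)
  have hI : ∀ k, Integrable (fun ω => ∑ i ∈ Finset.range k, (ρ i * r i ω + n i)) μ := fun k =>
    integrable_finsetSum _ fun i _ => hi i
  have hnn : ∀ k ω, 0 ≤ ρ k * r k ω := fun k ω => mul_nonneg (H.ρ_nonneg k) (H.dist_nonneg k ω)
  have hbdd : ∀ k, eLpNorm (fun ω => ∑ i ∈ Finset.range k, (ρ i * r i ω + n i) - r k ω ^ 2) 1 μ ≤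
      (C + ∑' i, n i + B).toNNReal := fun k => by
    have hd : Integrable (fun ω => ∑ i ∈ Finset.range k, (ρ i * r i ω + n i) - r k ω ^ 2) μ :=
      (hI k).sub (H.integrable_sq k)
    rw [eLpNorm_one_eq_lintegral_enorm, ← ofReal_integral_norm_eq_lintegral_enorm hd]
    refine ENNReal.ofReal_le_ofReal ?_
    calc ∫ ω, ‖∑ i ∈ Finset.range k, (ρ i * r i ω + n i) - r k ω ^ 2‖ ∂μ
        ≤ ∫ ω, (∑ i ∈ Finset.range k, (ρ i * r i ω + n i) + r k ω ^ 2) ∂μ := by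
          refine integral_mono hd.norm
            ((hI k).add (H.integrable_sq k)) fun ω => ?_
          refine (norm_sub_le _ _).trans (le_of_eq ?_)
          rw [Real.norm_of_nonneg (sq_nonneg _), Real.norm_of_nonneg (Finset.sum_nonneg fun i _ =>
            add_nonneg (hnn i ω) (H.n_nonneg i))]
      _ = ∑ i ∈ Finset.range k, ∫ ω, ρ i * r i ω ∂μ + ∑ i ∈ Finset.range k, n i
            + ∫ ω, r k ω ^ 2 ∂μ := by
          rw [integral_add (hI k) (H.integrable_sq k), integral_finsetSum _ fun i _ => hi i,
            ← Finset.sum_add_distrib]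
          congr 1
          refine Finset.sum_congr rfl fun i _ => ?_
          rw [integral_add ((H.integrable_dist i).const_mul _) (integrable_const _), integral_const,
            probReal_univ, one_smul]
      _ ≤ C + ∑' i, n i + B :=
          add_le_add (add_le_add (hC k) (hn.sum_le_tsum _ fun i _ => H.n_nonneg i)) (hB k)
  filter_upwards [H.submartingale.exists_ae_tendsto_of_bdd hbdd,
    ae_summable_of_sum_integral_le (fun k => (H.integrable_dist k).const_mul (ρ k)) hnn hC]
    with ω ⟨c, hc⟩ hω
  have hsq := ((hω.add hn).hasSum.tendsto_sum_nat).sub hc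
  simp only [sub_sub_cancel] at hsq
  refine ⟨_, hsq.sqrt.congr fun k => Real.sqrt_sq (H.dist_nonneg k ω)⟩

end IsQuasiFejer

end QuasiFejer

/-! ### From convergent distances to a convergent sequence. -/

section Opial

variable {E : Type*} {f : E → ℝ} {x : ℕ → E} {m : ℝ} {α : ℕ → ℝ}

/-- If `∑ α (f (x k) - m)` converges while `∑ α` diverges, then `f (x k)` comes frequently close
to the lower bound `m`. -/
lemma frequently_lt_of_summable_mul_sub (hα : ∀ k, 0 < α k) (hns : ¬ Summable α)
    (hsum : Summable fun k => α k * (f (x k) - m)) {ε : ℝ} (hε : 0 < ε) :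
    ∃ᶠ k in atTop, f (x k) < m + ε := by
  -- If `f (x k) ≥ m + ε` eventually, then `α k ≤ ε⁻¹ α k (f (x k) - m)`, and `α` would be summable.
  intro hev
  refine hns ((hsum.mul_left ε⁻¹).of_norm_bounded_eventually_nat ?_)
  filter_upwards [hev] with k hk
  rw [Real.norm_of_nonneg (hα k).le, inv_mul_eq_div, le_div_iff₀ hε]
  exact mul_le_mul_of_nonneg_left (by linarith) (hα k).le

variable [NormedAddCommGroup E] [ProperSpace E]

/-- Opial-type lemma: convergence to a minimizer from convergence of the distances to a dense
family of minimizers. -/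
lemma exists_tendsto_of_tendsto_norm_sub (hf : Continuous f) (hα : ∀ k, 0 < α k)
    (hns : ¬ Summable α) (hsum : Summable fun k => α k * (f (x k) - m)) (hm : ∀ y, m ≤ f y)
    {D : Set E} (hD : D.Nonempty) (hdense : {y | f y = m} ⊆ closure D)
    (hdist : ∀ s ∈ D, ∃ c, Tendsto (fun k => ‖x k - s‖) atTop (𝓝 c)) :
    ∃ y, f y = m ∧ Tendsto x atTop (𝓝 y) := by
  -- A subsequence with values below `m + 1 / (n + 1)`; distance convergence to one point makes it
  -- bounded, so it has a cluster point, which continuity makes a minimizer.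
  obtain ⟨φ, hφ, hφlt⟩ := extraction_forall_of_frequently fun n : ℕ =>
    frequently_lt_of_summable_mul_sub hα hns hsum (Nat.one_div_pos_of_nat (α := ℝ) (n := n))
  obtain ⟨s, hs⟩ := hD
  obtain ⟨c, hc⟩ := hdist s hs
  obtain ⟨R, hR⟩ := hc.bddAbove_range
  have hball : ∀ n, x (φ n) ∈ Metric.closedBall s R := fun n => by
    rw [mem_closedBall_iff_norm]
    exact hR ⟨φ n, rfl⟩
  obtain ⟨y, -, ψ, hψ, hy⟩ := tendsto_subseq_of_bounded Metric.isBounded_closedBall hball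
  have hfy : f y = m := by
    refine le_antisymm ?_ (hm y)
    have hlim : Tendsto (fun n : ℕ => m + 1 / ((n : ℝ) + 1)) atTop (𝓝 m) := by
      simpa using tendsto_one_div_add_atTop_nhds_zero_nat.const_add m
    exact le_of_tendsto_of_tendsto' ((hf.tendsto y).comp hy) (hlim.comp hψ.tendsto_atTop)
      fun n => (hφlt (ψ n)).le
  refine ⟨y, hfy, Metric.tendsto_atTop.2 fun ε hε => ?_⟩
  -- The cluster point `y` need not lie in `D`. A nearby `t ∈ D` serves instead: the whole sequence
  -- `‖x k - t‖` converges to `‖y - t‖ < ε / 2`.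
  obtain ⟨t, htD, ht⟩ := Metric.mem_closure_iff.1 (hdense hfy) (ε / 2) (half_pos hε)
  obtain ⟨b, hb⟩ := hdist t htD
  have hsub := hb.comp (hφ.comp hψ).tendsto_atTop
  have hby : b = ‖y - t‖ := tendsto_nhds_unique hsub ((hy.sub_const t).norm)
  rw [dist_eq_norm] at ht
  obtain ⟨N, hN⟩ := eventually_atTop.1 (hb.eventually_lt_const (hby ▸ ht))
  refine ⟨N, fun k hk => ?_⟩
  have h1 := dist_triangle_right (x k) y t
  rw [dist_eq_norm (x k) t, dist_eq_norm y t] at h1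
  linarith [hN k hk]

end Opial

/-! ### Summability and algebra of the constants. -/

section Parameters

variable {d l : ℕ} {lam αbar G : ℝ} {α h : ℕ → ℝ}

lemma rho_nonneg (hstep : IsStepDisc d l lam αbar α h) (hlam : 0 < lam) (k : ℕ) :
    0 ≤ rho d l lam α h k := by
  have := hstep.α_pos k
  have := hstep.h_pos k
  unfold rho
  positivity

lemma noiseTerm_nonneg (hG : 0 < G) (k : ℕ) : 0 ≤ noiseTerm d l lam G α h k := by
  unfold noiseTerm
  positivity

lemma summable_rho (hstep : IsStepDisc d l lam αbar α h) : Summable (rho d l lam α h) :=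
  hstep.summable_mul.mul_left _

/-- The sequence `h` may be unbounded, but `α² h² = (α h)²` is dominated by `(∑ α h) * α h`. -/
lemma summable_noiseTerm (hstep : IsStepDisc d l lam αbar α h) :
    Summable (noiseTerm d l lam G α h) := by
  have hpos : ∀ k, 0 ≤ α k * h k := fun k => (mul_pos (hstep.α_pos k) (hstep.h_pos k)).le
  have hsq : Summable fun k => (α k * h k) ^ 2 := by
    refine (hstep.summable_mul.mul_left (∑' k, α k * h k)).of_nonneg_of_le
      (fun k => sq_nonneg _) fun k => ?_
    rw [sq]
    exact mul_le_mul_of_nonneg_right (hstep.summable_mul.le_tsum k fun i _ => hpos i) (hpos k)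
  refine ((hsq.mul_left ((d : ℝ) / l * (lam ^ 2 * (d : ℝ) ^ 2 / (2 * l)))).add
    (hstep.summable_sq.mul_left ((d : ℝ) / l * (2 * G)))).congr fun k => ?_
  unfold noiseTerm
  ring

lemma driftTerm_nonneg (hstep : IsStepDisc d l lam αbar α h) (hlam : 0 < lam)
    (x₀ s : EuclideanSpace ℝ (Fin d)) (k : ℕ) : 0 ≤ driftTerm l lam G α h x₀ s k :=
  mul_nonneg (rho_nonneg hstep hlam k) (add_nonneg (Real.sqrt_nonneg _)
    (Finset.sum_nonneg fun i _ => rho_nonneg hstep hlam i))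

lemma summable_driftTerm (hstep : IsStepDisc d l lam αbar α h) (hlam : 0 < lam)
    (x₀ s : EuclideanSpace ℝ (Fin d)) : Summable (driftTerm l lam G α h x₀ s) := by
  refine ((summable_rho hstep).mul_right (√(constS l lam G α h x₀ s)
    + ∑' i, rho d l lam α h i)).of_nonneg_of_le (driftTerm_nonneg hstep hlam x₀ s) fun k => ?_
  refine mul_le_mul_of_nonneg_left (add_le_add_right ?_ _) (rho_nonneg hstep hlam k)
  exact (summable_rho hstep).sum_le_tsum _ fun i _ => rho_nonneg hstep hlam i

/-- Since `l Δ + d ᾱ = l / λ`, the prefactor of `constC` is the inverse of the decrease coefficient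
in the recursion. -/
lemma ratio_eq (hl : 1 ≤ l) (hlam : 0 < lam) :
    (l * Delta d l lam αbar + d * αbar) / (2 * l * Delta d l lam αbar) =
      (2 * lam * Delta d l lam αbar)⁻¹ := by
  have hl0 : (l : ℝ) ≠ 0 := by exact_mod_cast (Nat.one_le_iff_ne_zero.1 hl)
  have e : l * Delta d l lam αbar + d * αbar = l / lam := by
    unfold Delta
    field_simp
    ring
  rw [e]
  field_simp

end Parameters

/-! ### Jensen's inequality for the weighted average. -/

section Average

variable {d : ℕ} {𝒵 Ω₀ Ω : Type*} [MeasurableSpace Ω₀] {μ₀ : Measure Ω₀}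
  {F : EuclideanSpace ℝ (Fin d) → 𝒵 → ℝ} {Z : Ω₀ → 𝒵} {α : ℕ → ℝ}

lemma objective_average_sub_le (hFint : ∀ x, Integrable (fun ω => F x (Z ω)) μ₀)
    (hconv : ∀ z, ConvexOn ℝ Set.univ (fun x => F x z)) (hα : ∀ k, 0 < α k)
    (x : ℕ → Ω → EuclideanSpace ℝ (Fin d)) (m : ℝ) (k : ℕ) (ω : Ω) :
    objective μ₀ F Z (average α x k ω) - m ≤ (∑ i ∈ Finset.range (k + 1), α i)⁻¹ *
      ∑ i ∈ Finset.range (k + 1), α i * (objective μ₀ F Z (x i ω) - m) := by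
  have hA : 0 < ∑ i ∈ Finset.range (k + 1), α i :=
    Finset.sum_pos (fun i _ => hα i) Finset.nonempty_range_add_one
  have h := (convexOn_objective hFint hconv).map_centerMass_le (t := Finset.range (k + 1))
    (w := α) (p := fun i => x i ω) (fun i _ => (hα i).le) hA fun i _ => Set.mem_univ _
  simp only [Finset.centerMass, smul_eq_mul] at h
  simp_rw [mul_sub, Finset.sum_sub_distrib, ← Finset.sum_mul]
  rw [mul_sub, ← mul_assoc, inv_mul_cancel₀ hA.ne', one_mul]
  exact sub_le_sub_right h m

end Average

/-! ### The iterates as a quasi-Fejér process. -/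

section Convergence

variable {d l : ℕ} {𝒵 Ω₀ Ω : Type*} [MeasurableSpace 𝒵] [MeasurableSpace Ω₀]
  [mΩ : MeasurableSpace Ω] {μ₀ : Measure Ω₀} {μ : Measure Ω}
  {F : EuclideanSpace ℝ (Fin d) → 𝒵 → ℝ} {Z : Ω₀ → 𝒵} {lam G αbar : ℝ} {α h : ℕ → ℝ}
  {P : ℕ → Ω → Matrix (Fin d) (Fin l) ℝ} {Zs : ℕ → Ω → 𝒵}

/-- The iterates are stochastically quasi-Fejér with respect to every minimizer. -/
lemma isQuasiFejer_iterate [IsProbabilityMeasure μ₀] [IsProbabilityMeasure μ]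
    (hl : 1 ≤ l) (hld : l ≤ d) (hZ : Measurable Z) (hFmeas : ∀ x, Measurable (F x))
    (hFint : ∀ x, Integrable (fun ω => F x (Z ω)) μ₀)
    (hsmooth : IsSmooth F lam) (hunb : IsUnbiasedBounded μ₀ F Z G)
    (hconv : ∀ z, ConvexOn ℝ Set.univ (fun x => F x z))
    (hstep : IsStepDisc d l lam αbar α h) (hZs : ∀ k, Measurable (Zs k))
    (hZcopy : ∀ k, IdentDistrib (Zs k) Z μ μ₀) (hZindep : iIndepFun Zs μ)
    (hP : ∀ k, IsDirectionMatrix μ (P k)) (hPindep : iIndepFun P μ)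
    (hPZ : IndepFun (fun ω k => P k ω) (fun ω k => Zs k ω) μ)
    (x₀ : EuclideanSpace ℝ (Fin d)) {s : EuclideanSpace ℝ (Fin d)}
    (hs : IsMinOn (objective μ₀ F Z) Set.univ s) :
    IsQuasiFejer μ (historyFiltration (fun k => (hP k).measurable) hZs)
      (fun k ω => ‖iterate F α h x₀ P Zs k ω - s‖)
      (fun k ω => objective μ₀ F Z (iterate F α h x₀ P Zs k ω) - objective μ₀ F Z s)
      (rho d l lam α h) (noiseTerm d l lam G α h)
      (fun k => 2 * lam * Delta d l lam αbar * α k) where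
  measurable_dist k := (continuous_id.sub continuous_const).norm.measurable.comp
    (measurable_iterate hFmeas hsmooth _ hZs x₀ k)
  measurable_gap k := Measurable.sub_const ((continuous_objective hFint hconv).measurable.comp
    (measurable_iterate hFmeas hsmooth _ hZs x₀ k)) _
  dist_nonneg k ω := norm_nonneg _
  gap_nonneg k ω := sub_nonneg.2 (hs (Set.mem_univ _))
  ρ_nonneg := rho_nonneg hstep hsmooth.pos
  n_nonneg := noiseTerm_nonneg hunb.pos
  γ_nonneg k := by
    have := hsmooth.pos
    have := hstep.Delta_pos hl hld hsmooth.pos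
    have := hstep.α_pos k
    positivity
  gap_le := ⟨lam / 2, fun k ω => sub_le_of_isMinOn hsmooth.pos
    (objective_le_add_inner hFint hsmooth hunb) hs _⟩
  integrable_zero := integrable_const (‖x₀ - s‖ ^ 2)
  bound_nonneg k ω := (lintegral_step_le hl hld hFint hsmooth hunb hconv hstep (hP k) hs k _).1
  step k A hA := setLIntegral_norm_sq_iterate_succ_le hl hld hZ hFmeas hFint hsmooth hunb hconv
    hstep hZs hZcopy hZindep hP hPindep hPZ x₀ hs k hA

end Convergence

end SSZD

/-! ### The rate and the almost sure convergence. -/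

theorem theorem1 {d l : ℕ} (hl : 1 ≤ l) (hld : l ≤ d)
    {𝒵 Ω₀ Ω : Type*} [MeasurableSpace 𝒵] [MeasurableSpace Ω₀] [MeasurableSpace Ω]
    (μ₀ : Measure Ω₀) [IsProbabilityMeasure μ₀] (μ : Measure Ω) [IsProbabilityMeasure μ]
    (F : EuclideanSpace ℝ (Fin d) → 𝒵 → ℝ) (Z : Ω₀ → 𝒵) (hZ : Measurable Z)
    -- the objective `f(x) = E[F(x, Z)]` is well defined and has a minimizer
    (hFmeas : ∀ x, Measurable (F x))
    (hFint : ∀ x, Integrable (fun ω => F x (Z ω)) μ₀)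
    (hmin : ∃ x, IsMinOn (SSZD.objective μ₀ F Z) Set.univ x)
    -- smoothness, unbiasedness with bounded variance, convexity, parameters
    (lam G αbar : ℝ) (α h : ℕ → ℝ)
    (hsmooth : SSZD.IsSmooth F lam)
    (hunb : SSZD.IsUnbiasedBounded μ₀ F Z G)
    (hconv : ∀ z, ConvexOn ℝ Set.univ (fun x => F x z))
    (hstep : SSZD.IsStepDisc d l lam αbar α h)
    -- independent copies of `Z`, independent direction matrices, independent of each other
    (Zs : ℕ → Ω → 𝒵) (hZs : ∀ k, Measurable (Zs k))
    (hZcopy : ∀ k, IdentDistrib (Zs k) Z μ μ₀)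
    (hZindep : iIndepFun Zs μ)
    (P : ℕ → Ω → Matrix (Fin d) (Fin l) ℝ)
    (hP : ∀ k, SSZD.IsDirectionMatrix μ (P k))
    (hPindep : iIndepFun P μ)
    (hPZ : IndepFun (fun ω k => P k ω) (fun ω k => Zs k ω) μ)
    (x₀ : EuclideanSpace ℝ (Fin d)) :
    (∀ xs, IsMinOn (SSZD.objective μ₀ F Z) Set.univ xs →
      Summable (SSZD.noiseTerm d l lam G α h) ∧
      Summable (SSZD.driftTerm l lam G α h x₀ xs) ∧
      ∀ k : ℕ,
        Integrable (fun ω => SSZD.objective μ₀ F Z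
          (SSZD.average α (SSZD.iterate F α h x₀ P Zs) k ω)) μ ∧
        ∫ ω, (SSZD.objective μ₀ F Z (SSZD.average α (SSZD.iterate F α h x₀ P Zs) k ω)
            - ⨅ y, SSZD.objective μ₀ F Z y) ∂μ
          ≤ SSZD.constC l lam αbar G α h x₀ xs / ∑ i ∈ Finset.range (k + 1), α i) ∧
    ∃ X : Ω → EuclideanSpace ℝ (Fin d), Measurable X ∧
      (∀ᵐ ω ∂μ, IsMinOn (SSZD.objective μ₀ F Z) Set.univ (X ω)) ∧
      ∀ᵐ ω ∂μ, Tendsto (fun k => SSZD.iterate F α h x₀ P Zs k ω) atTop (𝓝 (X ω)) := by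
  have hH := fun {s} => SSZD.isQuasiFejer_iterate (s := s) hl hld hZ hFmeas hFint hsmooth hunb
    hconv hstep hZs hZcopy hZindep hP hPindep hPZ x₀
  have hρ := SSZD.summable_rho hstep
  have hn := SSZD.summable_noiseTerm (G := G) hstep
  have hmeas : ∀ k, Measurable (SSZD.iterate F α h x₀ P Zs k) := fun k =>
    (SSZD.measurable_iterate hFmeas hsmooth (fun k => (hP k).measurable) hZs x₀ k).mono
      (Filtration.le _ k) le_rfl
  have hf := SSZD.continuous_objective hFint hconv
  refine ⟨fun xs hxs => ⟨hn, SSZD.summable_driftTerm hstep hsmooth.pos x₀ xs, fun k => ?_⟩, ?_⟩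
  · have H := hH hxs
    set m := SSZD.objective μ₀ F Z xs with hm
    set A := ∑ i ∈ Finset.range (k + 1), α i with hA
    have hA0 : 0 < A :=
      Finset.sum_pos (fun i _ => hstep.α_pos i) Finset.nonempty_range_add_one
    have hmin : ∀ y, m ≤ SSZD.objective μ₀ F Z y := fun y => hxs (Set.mem_univ y)
    have hinf : ⨅ y, SSZD.objective μ₀ F Z y = m :=
      le_antisymm (ciInf_le ⟨m, Set.forall_mem_range.2 hmin⟩ xs) (le_ciInf hmin)
    have hle := SSZD.objective_average_sub_le hFint hconv hstep.α_pos
      (SSZD.iterate F α h x₀ P Zs) m k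
    have hsumint : Integrable (fun ω => A⁻¹ * ∑ i ∈ Finset.range (k + 1),
        α i * (SSZD.objective μ₀ F Z (SSZD.iterate F α h x₀ P Zs i ω) - m)) μ :=
      (integrable_finsetSum _ fun i _ => (H.integrable_gap i).const_mul (α i)).const_mul _
    have havg : Measurable (SSZD.average α (SSZD.iterate F α h x₀ P Zs) k) :=
      (Finset.measurable_sum _ fun i _ => (hmeas i).const_smul (α i)).const_smul A⁻¹
    have hint : Integrable (fun ω => SSZD.objective μ₀ F Z
        (SSZD.average α (SSZD.iterate F α h x₀ P Zs) k ω) - m) μ := by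
      refine Integrable.mono' hsumint
        ((hf.measurable.comp havg).sub_const m).aestronglyMeasurable (ae_of_all _ fun ω => ?_)
      rw [Real.norm_of_nonneg (sub_nonneg.2 (hmin _))]
      exact hle ω
    refine ⟨(hint.add (integrable_const m)).congr (ae_of_all _ fun ω => sub_add_cancel _ _), ?_⟩
    rw [hinf]
    have hΔ := hstep.Delta_pos hl hld hsmooth.pos
    have hlam := hsmooth.pos
    have hS : ∀ k, ∫ ω, ‖SSZD.iterate F α h x₀ P Zs 0 ω - xs‖ ^ 2 ∂μ
        + ∑ i ∈ Finset.range k, SSZD.noiseTerm d l lam G α h i ≤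
        SSZD.constS l lam G α h x₀ xs := fun k => by
      have e : ∫ ω, ‖SSZD.iterate F α h x₀ P Zs 0 ω - xs‖ ^ 2 ∂μ = ‖x₀ - xs‖ ^ 2 := by
        simp [SSZD.iterate]
      rw [e]
      exact add_le_add_right (hn.sum_le_tsum _ fun i _ => H.n_nonneg i) _
    have hgap := H.sum_integral_gap_le hS (k + 1)
    have hdrift := (SSZD.summable_driftTerm (G := G) hstep hlam x₀ xs).sum_le_tsum
      (Finset.range (k + 1)) fun i _ => SSZD.driftTerm_nonneg hstep hlam x₀ xs i
    have hgap' : 2 * lam * SSZD.Delta d l lam αbar * ∑ i ∈ Finset.range (k + 1), α i *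
        ∫ ω, (SSZD.objective μ₀ F Z (SSZD.iterate F α h x₀ P Zs i ω) - m) ∂μ ≤
        SSZD.constS l lam G α h x₀ xs + ∑' j, SSZD.driftTerm l lam G α h x₀ xs j := by
      rw [Finset.mul_sum]
      simp_rw [← mul_assoc]
      exact hgap.trans (add_le_add_right hdrift _)
    calc ∫ ω, (SSZD.objective μ₀ F Z (SSZD.average α (SSZD.iterate F α h x₀ P Zs) k ω) - m) ∂μ
        ≤ ∫ ω, A⁻¹ * ∑ i ∈ Finset.range (k + 1),
          α i * (SSZD.objective μ₀ F Z (SSZD.iterate F α h x₀ P Zs i ω) - m) ∂μ :=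
          integral_mono hint hsumint hle
      _ = (∑ i ∈ Finset.range (k + 1), α i *
          ∫ ω, (SSZD.objective μ₀ F Z (SSZD.iterate F α h x₀ P Zs i ω) - m) ∂μ) / A := by
          rw [integral_const_mul, integral_finsetSum _ fun i _ =>
            (H.integrable_gap i).const_mul (α i), inv_mul_eq_div]
          simp_rw [integral_const_mul]
      _ ≤ SSZD.constC l lam αbar G α h x₀ xs / A := by
          refine div_le_div_of_nonneg_right ?_ hA0.le
          rw [SSZD.constC, SSZD.ratio_eq hl hlam, inv_mul_eq_div, le_div_iff₀ (by positivity)]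
          linarith
  · obtain ⟨xs, hxs⟩ := hmin
    set m := SSZD.objective μ₀ F Z xs with hm
    have hmin : ∀ y, m ≤ SSZD.objective μ₀ F Z y := fun y => hxs (Set.mem_univ y)
    have hiff : ∀ y, SSZD.objective μ₀ F Z y = m → IsMinOn (SSZD.objective μ₀ F Z) Set.univ y :=
      fun y hy z _ => by simpa [hy] using hmin z
    -- The null set off which `‖x_k - s‖` converges depends on `s`; a countable dense set of
    -- minimizers needs only a countable union of them.
    obtain ⟨D, hDsub, hDc, hDdense⟩ := (TopologicalSpace.IsSeparable.of_separableSpace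
      {y | SSZD.objective μ₀ F Z y = m}).exists_countable_dense_subset
    have hDne : D.Nonempty := closure_nonempty_iff.1 ⟨xs, hDdense hm.symm⟩
    have hdist : ∀ᵐ ω ∂μ, ∀ s ∈ D,
        ∃ c, Tendsto (fun k => ‖SSZD.iterate F α h x₀ P Zs k ω - s‖) atTop (𝓝 c) :=
      (ae_ball_iff hDc).2 fun s hs => (hH (hiff s (hDsub hs))).ae_exists_tendsto_dist hρ hn
    have hsum : ∀ᵐ ω ∂μ, Summable fun k =>
        α k * (SSZD.objective μ₀ F Z (SSZD.iterate F α h x₀ P Zs k ω) - m) := by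
      filter_upwards [(hH hxs).ae_summable_gap hρ hn] with ω hω
      have hΔ := hstep.Delta_pos hl hld hsmooth.pos
      have hlam := hsmooth.pos
      refine (hω.mul_left (2 * lam * SSZD.Delta d l lam αbar)⁻¹).congr fun k => ?_
      rw [mul_assoc _ (α k), inv_mul_cancel_left₀ (by positivity)]
    have hlim : ∀ᵐ ω ∂μ, ∃ y, SSZD.objective μ₀ F Z y = m ∧
        Tendsto (fun k => SSZD.iterate F α h x₀ P Zs k ω) atTop (𝓝 y) := by
      filter_upwards [hdist, hsum] with ω hω₁ hω₂
      exact SSZD.exists_tendsto_of_tendsto_norm_sub hf hstep.α_pos hstep.not_summable hω₂ hmin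
        hDne hDdense hω₁
    -- The pointwise limits are assembled into a measurable `X`; uniqueness of limits then makes `X`
    -- a minimizer almost surely.
    obtain ⟨X, hX, hXlim⟩ := measurable_limit_of_tendsto_metrizable_ae
      (fun k => (hmeas k).aemeasurable) (hlim.mono fun ω ⟨y, _, hy⟩ => ⟨y, hy⟩)
    refine ⟨X, hX, ?_, hXlim⟩
    filter_upwards [hlim, hXlim] with ω ⟨y, hy, hty⟩ htX
    exact hiff _ (tendsto_nhds_unique htX hty ▸ hy)
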